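/- Let $\mathbb{C}\{x_1,\dots,x_4\}$ be the ring of convergent power series and let $h=x_1^m x_4+h_2(x_2,x_3)+h_3(x_1,\dots,x_4)\in\mathbb{C}\{x_1,\dots,x_4\}$, where $m\ge 1$, $h_2$ is a (possibly zero) quadratic form in $x_2,x_3$ with coefficients in $\mathbb{C}$, and $h_3\in(x_2,x_3,x_4)^3$. Let $(X,P)\subset(\mathbb{C}^4,0)$ be the hypersurface germ $h=0$, with local ring $\mathcal{O}_X=\mathbb{C}\{x_1,\dots,x_4\}/(h)$; it contains the $x_1$-axis $C$, whose ideal is $I=(x_2,x_3,x_4)\subset\mathcal{O}_X$. Put $\mathcal{O}_C=\mathcal{O}_X/I$, let $I^{(n)}$ be the $n$-th symbolic power of $I$, let $\operatorname{gr}_C^n\mathcal{O}=I^{(n)}/I^{(n+1)}$, and let $\operatorname{gr}_C^{\bullet}\mathcal{O}=\bigoplus_{n\ge0}\operatorname{gr}_C^n\mathcal{O}$ be the resulting graded $\mathcal{O}_C$-algebra. Then $x_4\in I^{(2)}$. Below, $x_2,x_3,x_4$ also denote their classes in $\operatorname{gr}_C^1\mathcal{O}$, $\operatorname{gr}_C^1\mathcal{O}$,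 $\operatorname{gr}_C^2\mathcal{O}$, respectively. 1. If $h_2=0$, then the multiplication map $S^2_{\mathcal{O}_C}\operatorname{gr}_C^1\mathcal{O}\to\operatorname{gr}_C^2\mathcal{O}$ is an isomorphism. 2. If $h_2\ne0$, then there is an isomorphism of graded $\mathcal{O}_C$-algebras $\mathcal{O}_C[x_2,x_3,x_4]/(x_1^mx_4+h_2)\simeq\operatorname{gr}_C^{\bullet}\mathcal{O}$, where the variables $x_2,x_3,x_4$ have degrees $1,1,2$ and are sent to the classes of $x_2,x_3,x_4$. 3. If the coefficient of $x_3^2$ in $h_2$ is nonzero, then $\operatorname{gr}_C^{\bullet}\mathcal{O}=\mathcal{O}_C[x_2,x_4]\oplus x_3\,\mathcal{O}_C[x_2,x_4]$: every element can be written as $p(x_2,x_4)+x_3\,q(x_2,x_4)$ with unique polynomials $p,q$ in two variables over $\mathcal{O}_C$. 4. If $h_2=x_2x_3$, then $\operatorname{gr}_C^{\bullet}\mathcal{O}=\mathcal{O}_C[x_4]\oplus x_2\,\mathcal{O}_C[x_2,x_4]\oplus x_3\,\mathcal{O}_C[x_3,x_4]$: every element can be written as $p(x_4)+x_2\,q(x_2,x_4)+x_3\,r(x_3,x_4)$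 with unique polynomials $p,q,r$ over $\mathcal{O}_C$. -/

import Mathlib

open scoped DirectSum TensorProduct

/-! ### Symbolic powers and the graded algebra `⨁ I⁽ⁿ⁾ / I⁽ⁿ⁺¹⁾` -/

section SymbolicPowers

variable {R : Type*} [CommRing R]

/-- The `n`-th symbolic power of an ideal `I`: the elements which lie in `I ^ n` after
multiplication by an element that is a non-zero-divisor modulo `I`. For a prime ideal `I` this is
the contraction of `Iⁿ R_I`, see `mem_symbolicPower_iff_of_isPrime`. -/
def symbolicPower (I : Ideal R) (n : ℕ) : Ideal R where
  carrier := {a | ∃ s : R, Ideal.Quotient.mk I s ∈ nonZeroDivisors (R ⧸ I) ∧ s * a ∈ I ^ n}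
  zero_mem' := ⟨1, by simp [one_mem], by simp⟩
  add_mem' := by
    rintro a b ⟨s, hs, hsa⟩ ⟨t, ht, htb⟩
    refine ⟨s * t, by rw [map_mul]; exact mul_mem hs ht, ?_⟩
    have h1 : t * (s * a) ∈ I ^ n := Ideal.mul_mem_left _ _ hsa
    have h2 : s * (t * b) ∈ I ^ n := Ideal.mul_mem_left _ _ htb
    have h3 : s * t * (a + b) = t * (s * a) + s * (t * b) := by ring
    rw [h3]
    exact add_mem h1 h2
  smul_mem' := by
    rintro c a ⟨s, hs, hsa⟩
    refine ⟨s, hs, ?_⟩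
    have h1 : s * (c • a) = c * (s * a) := by simp only [smul_eq_mul]; ring
    rw [h1]
    exact Ideal.mul_mem_left _ _ hsa

theorem mem_symbolicPower {I : Ideal R} {n : ℕ} {a : R} : a ∈ symbolicPower I n ↔
    ∃ s : R, Ideal.Quotient.mk I s ∈ nonZeroDivisors (R ⧸ I) ∧ s * a ∈ I ^ n := Iff.rfl

theorem mem_symbolicPower_iff_of_isPrime {I : Ideal R} [I.IsPrime] {n : ℕ} {a : R} :
    a ∈ symbolicPower I n ↔ ∃ s : R, s ∉ I ∧ s * a ∈ I ^ n := by
  simp only [mem_symbolicPower, mem_nonZeroDivisors_iff_ne_zero, ne_eq,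
    Ideal.Quotient.eq_zero_iff_mem]

theorem mem_symbolicPower_of_mem_pow {I : Ideal R} {n : ℕ} {a : R} (ha : a ∈ I ^ n) :
    a ∈ symbolicPower I n :=
  ⟨1, by simp [one_mem], by simpa using ha⟩

theorem mem_symbolicPower_one {I : Ideal R} {a : R} (ha : a ∈ I) : a ∈ symbolicPower I 1 :=
  mem_symbolicPower_of_mem_pow (by simpa using ha)

theorem mul_mem_symbolicPower {I : Ideal R} {i j : ℕ} {a b : R} (ha : a ∈ symbolicPower I i)
    (hb : b ∈ symbolicPower I j) : a * b ∈ symbolicPower I (i + j) := by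
  obtain ⟨s, hs, hsa⟩ := ha
  obtain ⟨t, ht, htb⟩ := hb
  refine ⟨s * t, by rw [map_mul]; exact mul_mem hs ht, ?_⟩
  rw [mul_mul_mul_comm, pow_add]
  exact Ideal.mul_mem_mul hsa htb

variable (I : Ideal R)

/-- The module `grⁿ = I⁽ⁿ⁾ / I⁽ⁿ⁺¹⁾`. -/
def GrPiece (n : ℕ) : Type _ :=
  symbolicPower I n ⧸ (symbolicPower I (n + 1)).submoduleOf (symbolicPower I n)

namespace GrPiece

noncomputable instance (n : ℕ) : AddCommGroup (GrPiece I n) :=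
  inferInstanceAs (AddCommGroup
    (symbolicPower I n ⧸ (symbolicPower I (n + 1)).submoduleOf (symbolicPower I n)))

noncomputable instance (n : ℕ) : Module R (GrPiece I n) :=
  inferInstanceAs (Module R
    (symbolicPower I n ⧸ (symbolicPower I (n + 1)).submoduleOf (symbolicPower I n)))

/-- The projection `I⁽ⁿ⁾ → grⁿ`. -/
noncomputable def proj (n : ℕ) : symbolicPower I n →ₗ[R] GrPiece I n :=
  Submodule.mkQ ((symbolicPower I (n + 1)).submoduleOf (symbolicPower I n))

variable {I}

/-- The class in `grⁿ` of an element of `I⁽ⁿ⁾`. -/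
noncomputable def mk (n : ℕ) (a : R) (ha : a ∈ symbolicPower I n) : GrPiece I n :=
  proj I n ⟨a, ha⟩

theorem mk_eq_zero_iff {n : ℕ} {a : R} {ha : a ∈ symbolicPower I n} :
    mk n a ha = 0 ↔ a ∈ symbolicPower I (n + 1) :=
  Submodule.Quotient.mk_eq_zero _

theorem exists_mk {n : ℕ} (x : GrPiece I n) : ∃ a ha, x = mk n a ha := by
  obtain ⟨⟨a, ha⟩, rfl⟩ := Submodule.mkQ_surjective _ x
  exact ⟨a, ha, rfl⟩

theorem mk_add {n : ℕ} {a b : R} (ha : a ∈ symbolicPower I n) (hb : b ∈ symbolicPower I n) :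
    mk n a ha + mk n b hb = mk n (a + b) (add_mem ha hb) := rfl

theorem smul_mk {n : ℕ} {r a : R} (ha : a ∈ symbolicPower I n) :
    r • mk n a ha = mk n (r * a) (Ideal.mul_mem_left _ _ ha) := rfl

variable (I) in
theorem isTorsionBySet (n : ℕ) : Module.IsTorsionBySet R (GrPiece I n) I := by
  rintro x ⟨r, hr⟩
  obtain ⟨a, ha, rfl⟩ := exists_mk x
  change r • mk n a ha = 0
  rw [smul_mk, mk_eq_zero_iff, add_comm]
  exact mul_mem_symbolicPower (mem_symbolicPower_one hr) ha

/-- `grⁿ` as a module over `R ⧸ I`. -/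
noncomputable instance (n : ℕ) : Module (R ⧸ I) (GrPiece I n) := (isTorsionBySet I n).module

theorem mk_smul_mk {n : ℕ} {r a : R} (ha : a ∈ symbolicPower I n) :
    Ideal.Quotient.mk I r • mk n a ha = mk n (r * a) (Ideal.mul_mem_left _ _ ha) := rfl

/-- The product `grⁱ × grʲ → grⁱ⁺ʲ` induced by the product of `R`. -/
noncomputable def mul {i j : ℕ} (x : GrPiece I i) (y : GrPiece I j) : GrPiece I (i + j) :=
  Quotient.liftOn₂' x y
    (fun a b => mk (i + j) (a.1 * b.1) (mul_mem_symbolicPower a.2 b.2)) <| by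
      rintro ⟨a, ha⟩ ⟨b, hb⟩ ⟨a', ha'⟩ ⟨b', hb'⟩ haa hbb
      have haa : a - a' ∈ symbolicPower I (i + 1) :=
        (Submodule.quotientRel_def ((symbolicPower I (i + 1)).submoduleOf (symbolicPower I i))).1 haa
      have hbb : b - b' ∈ symbolicPower I (j + 1) :=
        (Submodule.quotientRel_def ((symbolicPower I (j + 1)).submoduleOf (symbolicPower I j))).1 hbb
      refine (Submodule.Quotient.eq _).2 ?_
      change a * b - a' * b' ∈ symbolicPower I (i + j + 1)
      have h1 : a * b - a' * b' = (a - a') * b + a' * (b - b') := by ring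
      have h2 := mul_mem_symbolicPower haa hb
      have h3 := mul_mem_symbolicPower ha' hbb
      rw [add_right_comm] at h2
      rw [h1]
      exact add_mem h2 h3

theorem mul_mk {i j : ℕ} {a b : R} (ha : a ∈ symbolicPower I i) (hb : b ∈ symbolicPower I j) :
    mul (mk i a ha) (mk j b hb) = mk (i + j) (a * b) (mul_mem_symbolicPower ha hb) := rfl

theorem gradedMk_congr {i j : ℕ} {a b : R} (ha : a ∈ symbolicPower I i)
    (hb : b ∈ symbolicPower I j) (hij : i = j) (hab : a = b) :
    GradedMonoid.mk (A := GrPiece I) i (mk i a ha) = GradedMonoid.mk j (mk j b hb) := by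
  subst hij hab
  rfl

theorem mem_symbolicPower_zero (a : R) : a ∈ symbolicPower I 0 :=
  mem_symbolicPower_of_mem_pow (by simp)

noncomputable instance : GradedMonoid.GMul (GrPiece I) := ⟨mul⟩

noncomputable instance : GradedMonoid.GOne (GrPiece I) := ⟨mk 0 1 (mem_symbolicPower_zero 1)⟩

/-- `⨁ₙ grⁿ` is a commutative graded ring. -/
noncomputable instance : DirectSum.GCommRing (GrPiece I) where
  mul := mul
  one := mk 0 1 (mem_symbolicPower_zero 1)
  mul_zero := by
    intro i j x
    obtain ⟨a, ha, rfl⟩ := exists_mk x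
    exact mk_eq_zero_iff.2 (by simp)
  zero_mul := by
    intro i j x
    obtain ⟨a, ha, rfl⟩ := exists_mk x
    exact mk_eq_zero_iff.2 (by simp)
  mul_add := by
    intro i j x y z
    obtain ⟨a, ha, rfl⟩ := exists_mk x
    obtain ⟨b, hb, rfl⟩ := exists_mk y
    obtain ⟨c, hc, rfl⟩ := exists_mk z
    simp only [mk_add, mul_mk, mul_add]
  add_mul := by
    intro i j x y z
    obtain ⟨a, ha, rfl⟩ := exists_mk x
    obtain ⟨b, hb, rfl⟩ := exists_mk y
    obtain ⟨c, hc, rfl⟩ := exists_mk z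
    simp only [mk_add, mul_mk, add_mul]
  one_mul := by
    rintro ⟨i, x⟩
    obtain ⟨a, ha, rfl⟩ := exists_mk x
    exact gradedMk_congr _ _ (zero_add i) (one_mul a)
  mul_one := by
    rintro ⟨i, x⟩
    obtain ⟨a, ha, rfl⟩ := exists_mk x
    exact gradedMk_congr _ _ (add_zero i) (mul_one a)
  mul_assoc := by
    rintro ⟨i, x⟩ ⟨j, y⟩ ⟨k, z⟩
    obtain ⟨a, ha, rfl⟩ := exists_mk x
    obtain ⟨b, hb, rfl⟩ := exists_mk y
    obtain ⟨c, hc, rfl⟩ := exists_mk z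
    exact gradedMk_congr _ _ (add_assoc i j k) (mul_assoc a b c)
  mul_comm := by
    rintro ⟨i, x⟩ ⟨j, y⟩
    obtain ⟨a, ha, rfl⟩ := exists_mk x
    obtain ⟨b, hb, rfl⟩ := exists_mk y
    exact gradedMk_congr _ _ (add_comm i j) (mul_comm a b)
  natCast n := mk 0 n (mem_symbolicPower_zero _)
  natCast_zero := mk_eq_zero_iff.2 (by simp)
  natCast_succ n := by
    change mk 0 _ _ = mk 0 _ _ + mk 0 _ _
    simp only [mk_add, Nat.cast_succ]
  intCast n := mk 0 n (mem_symbolicPower_zero _)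
  intCast_ofNat n := by simp only [Int.cast_natCast]
  intCast_negSucc_ofNat n := by
    simp only [Int.cast_negSucc]
    rfl

/-- The map `R ⧸ I → gr⁰`. -/
noncomputable def ofQuotient : R ⧸ I →+ GrPiece I 0 where
  toFun r := r • mk 0 1 (mem_symbolicPower_zero 1)
  map_zero' := zero_smul _ _
  map_add' _ _ := add_smul _ _ _

/-- `⨁ₙ grⁿ` is an algebra over `R ⧸ I` with structure map `R ⧸ I → gr⁰`. -/
noncomputable instance : DirectSum.GAlgebra (R ⧸ I) (GrPiece I) where
  toFun := ofQuotient
  map_one := one_smul _ _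
  map_mul r s := by
    obtain ⟨r, rfl⟩ := Ideal.Quotient.mk_surjective r
    obtain ⟨s, rfl⟩ := Ideal.Quotient.mk_surjective s
    exact gradedMk_congr (i := 0) (j := 0 + 0) (a := (r * s) * 1) (b := (r * 1) * (s * 1))
      (mem_symbolicPower_zero _) (mem_symbolicPower_zero _) rfl (by ring)
  commutes r x := mul_comm _ _
  smul_def := by
    rintro r ⟨i, x⟩
    obtain ⟨r, rfl⟩ := Ideal.Quotient.mk_surjective r
    obtain ⟨a, ha, rfl⟩ := exists_mk x
    exact gradedMk_congr (i := i) (j := 0 + i) (a := r * a) (b := (r * 1) * a)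
      (Ideal.mul_mem_left _ _ ha) (mul_mem_symbolicPower (mem_symbolicPower_zero _) ha)
      (zero_add i).symm (by ring)

end GrPiece

/-- The graded algebra `gr^• = ⨁ₙ I⁽ⁿ⁾ / I⁽ⁿ⁺¹⁾` of an ideal, a commutative `R ⧸ I`-algebra. -/
abbrev GrAlgebra : Type _ := ⨁ n, GrPiece I n

variable {I} in
/-- The class of `a ∈ I⁽ⁿ⁾` as a homogeneous element of degree `n` of `gr^•`. -/
noncomputable def GrAlgebra.cls (n : ℕ) (a : R) (ha : a ∈ symbolicPower I n) : GrAlgebra I :=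
  DirectSum.of (GrPiece I) n (GrPiece.mk n a ha)

end SymbolicPowers

/-! ### Convergent power series and hypersurface germs -/

theorem card_antidiagonal_le_two_pow {k : ℕ} (n : Fin k →₀ ℕ) :
    (Finset.HasAntidiagonal.antidiagonal n).card ≤ 2 ^ Finsupp.degree n := by
  have h1 : (Finset.HasAntidiagonal.antidiagonal n).card ≤ (Finset.Iic n).card := by
    refine Finset.card_le_card_of_injOn Prod.fst ?_ ?_
    · intro p hp
      have hp' : p.1 + p.2 = n := by simpa using hp
      simpa using hp' ▸ le_self_add
    · intro p hp q hq hpq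
      have hp' : p.1 + p.2 = n := by simpa using hp
      have hq' : q.1 + q.2 = n := by simpa using hq
      refine Prod.ext hpq ?_
      have : p.1 + p.2 = p.1 + q.2 := by rw [hp', hpq, hq']
      exact add_left_cancel this
  refine h1.trans ?_
  rw [Finsupp.card_Iic, Finsupp.degree_apply, ← Finset.prod_pow_eq_pow_sum]
  refine Finset.prod_le_prod' fun i _ => ?_
  rw [Nat.card_Iic]
  exact Nat.lt_two_pow_self

/-- The subalgebra of convergent power series in `k` variables: the formal power series whose
coefficients grow at most geometrically in the total degree. -/
noncomputable def convSubalgebra (k : ℕ) : Subalgebra ℂ (MvPowerSeries (Fin k) ℂ) where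
  carrier := {f | ∃ A r : ℝ, 0 < r ∧ ∀ n : Fin k →₀ ℕ,
    ‖MvPowerSeries.coeff n f‖ ≤ A * r ^ Finsupp.degree n}
  mul_mem' := by
    rintro f g ⟨A, r, hr, hf⟩ ⟨B, s, hs, hg⟩
    have hA : 0 ≤ A := by simpa using (norm_nonneg _).trans (hf 0)
    have hB : 0 ≤ B := by simpa using (norm_nonneg _).trans (hg 0)
    have hm : 0 < max r s := lt_max_of_lt_left hr
    refine ⟨A * B, 2 * max r s, by positivity, fun n => ?_⟩
    classical
    rw [MvPowerSeries.coeff_mul]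
    have hterm : ∀ p ∈ Finset.HasAntidiagonal.antidiagonal n,
        ‖MvPowerSeries.coeff p.1 f * MvPowerSeries.coeff p.2 g‖ ≤
          A * B * max r s ^ Finsupp.degree n := by
      intro p hp
      have hp' : p.1 + p.2 = n := by simpa using hp
      rw [norm_mul, ← hp', map_add, pow_add]
      calc _ ≤ (A * r ^ Finsupp.degree p.1) * (B * s ^ Finsupp.degree p.2) :=
            mul_le_mul (hf _) (hg _) (norm_nonneg _) (by positivity)
        _ ≤ (A * max r s ^ Finsupp.degree p.1) * (B * max r s ^ Finsupp.degree p.2) := by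
            gcongr
            · exact le_max_left _ _
            · exact le_max_right _ _
        _ = _ := by ring
    refine (norm_sum_le_of_le _ hterm).trans ?_
    rw [Finset.sum_const, nsmul_eq_mul, mul_pow]
    have hc : ((Finset.HasAntidiagonal.antidiagonal n).card : ℝ) ≤ 2 ^ Finsupp.degree n := by
      exact_mod_cast card_antidiagonal_le_two_pow n
    calc _ ≤ (2 : ℝ) ^ Finsupp.degree n * (A * B * max r s ^ Finsupp.degree n) := by gcongr
      _ = _ := by ring
  add_mem' := by
    rintro f g ⟨A, r, hr, hf⟩ ⟨B, s, hs, hg⟩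
    have hA : 0 ≤ A := by simpa using (norm_nonneg _).trans (hf 0)
    have hB : 0 ≤ B := by simpa using (norm_nonneg _).trans (hg 0)
    have hm : 0 < max r s := lt_max_of_lt_left hr
    refine ⟨A + B, max r s, hm, fun n => ?_⟩
    rw [map_add, add_mul]
    refine (norm_add_le _ _).trans (add_le_add ((hf n).trans ?_) ((hg n).trans ?_))
    · gcongr
      exact le_max_left _ _
    · gcongr
      exact le_max_right _ _
  algebraMap_mem' := by
    intro c
    refine ⟨‖c‖, 1, one_pos, fun n => ?_⟩
    classical
    rw [MvPowerSeries.algebraMap_apply, MvPowerSeries.coeff_C]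
    split_ifs <;> simp

/-- The ring `ℂ{x₁, …, x_k}` of convergent power series. -/
def ConvSeries (k : ℕ) : Type := convSubalgebra k

namespace ConvSeries

noncomputable instance (k : ℕ) : CommRing (ConvSeries k) :=
  inferInstanceAs (CommRing (convSubalgebra k))

noncomputable instance (k : ℕ) : Algebra ℂ (ConvSeries k) :=
  inferInstanceAs (Algebra ℂ (convSubalgebra k))

/-- The coordinate functions; `x i` is the variable `x_{i+1}` of `ℂ{x₁, …, x_k}`. -/
noncomputable def x {k : ℕ} (i : Fin k) : ConvSeries k :=
  ⟨MvPowerSeries.X i, 1, 1, one_pos, fun n => by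
    classical
    rw [MvPowerSeries.coeff_X]
    split_ifs <;> simp⟩

end ConvSeries

/-- The local ring `𝒪_X = ℂ{x₁, x₂, x₃, x₄} / (h)` of the hypersurface germ `h = 0`. -/
def HypersurfaceRing (h : ConvSeries 4) : Type := ConvSeries 4 ⧸ Ideal.span {h}

noncomputable instance (h : ConvSeries 4) : CommRing (HypersurfaceRing h) :=
  inferInstanceAs (CommRing (ConvSeries 4 ⧸ Ideal.span {h}))

noncomputable instance (h : ConvSeries 4) : Algebra ℂ (HypersurfaceRing h) :=
  inferInstanceAs (Algebra ℂ (ConvSeries 4 ⧸ Ideal.span {h}))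

namespace HypersurfaceRing

variable (h : ConvSeries 4)

/-- The restriction map `ℂ{x₁, x₂, x₃, x₄} → 𝒪_X`. -/
noncomputable def mk : ConvSeries 4 →ₐ[ℂ] HypersurfaceRing h :=
  Ideal.Quotient.mkₐ ℂ (Ideal.span {h})

/-- The restriction to `X` of the coordinates; `x h i` is the class of `x_{i+1}`. -/
noncomputable def x (i : Fin 4) : HypersurfaceRing h := mk h (ConvSeries.x i)

/-- The ideal `I = (x₂, x₃, x₄)` of the `x₁`-axis `C` in `X`. -/
noncomputable def axisIdeal : Ideal (HypersurfaceRing h) :=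
  Ideal.span {x h 1, x h 2, x h 3}

/-- The ring `𝒪_C = 𝒪_X / I`. -/
abbrev AxisRing : Type := HypersurfaceRing h ⧸ axisIdeal h

/-- The coordinate `x₁` on `C`. -/
noncomputable def t : AxisRing h := Ideal.Quotient.mk (axisIdeal h) (x h 0)

theorem x_one_mem : x h 1 ∈ symbolicPower (axisIdeal h) 1 :=
  mem_symbolicPower_one (Ideal.subset_span (by simp))

theorem x_two_mem : x h 2 ∈ symbolicPower (axisIdeal h) 1 :=
  mem_symbolicPower_one (Ideal.subset_span (by simp))

/-- The relation `x₁ᵐ x₄ + h₂(x₂, x₃)` in `𝒪_C[x₂, x₃, x₄]`, with the variables numbered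
`x₂ = X 0`, `x₃ = X 1`, `x₄ = X 2`. -/
noncomputable def relation (m : ℕ) (h₂ : MvPolynomial (Fin 2) ℂ) :
    MvPolynomial (Fin 3) (AxisRing h) :=
  MvPolynomial.C (t h) ^ m * MvPolynomial.X 2 +
    MvPolynomial.aeval ![MvPolynomial.X 0, MvPolynomial.X 1] h₂

end HypersurfaceRing

/-! Everything is computed upstairs in `ConvSeries 4`. Give x₂, x₃, x₄ positive weights, and let F_n
be the ideal generated by their monomials of weight at least n. Comparing power series coefficients
shows that the coordinates are quasi-regular (`isWeightedQuasiRegular_normal`). So an element of F_n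
has a unique initial form of degree n, a weighted homogeneous polynomial over 𝒪_C. The relation
`IsSymbol` records it, and no associated graded ring is needed.

Suppose h₂ ≠ 0 and take weights 1, 1, 2. The initial form of h is g = x₁ᵐx₄ + h₂, since h₃ lies in
F_3. Some coefficient of h₂ is a nonzero constant, hence a unit, so g is regular modulo every ideal
of 𝒪_C (`coeff_mem_of_coeff_relation_mul_mem`). It follows that F_n + (h) is saturated with respect
to elements that do not vanish on C (`mem_weightFiltration_sup_of_mul_mem`). As F_n contains the
n-th power of (x₂, x₃, x₄), the preimage of I⁽ⁿ⁾ lies in F_n + (h). Conversely x₁ᵐx₄ = -(h₂ + h₃) on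
X puts x₄ in I⁽²⁾, so F_n maps into I⁽ⁿ⁾. Thus I⁽ⁿ⁾ is the image of F_n, and the only relations
between the classes are multiples of g (`exists_presentation`). The two normal forms are division by
g with leading monomial x₃², respectively x₂x₃.

Suppose h₂ = 0. Then x₁ᵐx₄ is not regular modulo x₁, but x₄ even lies in I⁽³⁾. With weights 1, 1, 3
the equation h lies in F_3, so it imposes nothing on gr¹ and gr², where the classes of x₂, x₃,
respectively of their quadratic monomials, are free generators (`exists_symmetricSquare_equiv`). -/

open MvPolynomial

/-! ### Polynomials with a unit coefficient at an extremal monomial -/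

section UnitCoefficient

variable {σ B : Type*} [CommRing B]

/-- If `g` has a unit coefficient at a monomial `β` which is the unique one of minimal weight, then
the coefficients of `r` can be recovered from those coefficients of `g * r` whose exponents are at
least `β`. -/
theorem MvPolynomial.coeff_mem_of_coeff_mul_mem {g : MvPolynomial σ B} (ν : σ → ℕ) (β : σ →₀ ℕ)
    (hβ : IsUnit (coeff β g))
    (hν : ∀ x ∈ g.support, x ≠ β → Finsupp.weight ν β < Finsupp.weight ν x)
    (J : Ideal B) (r : MvPolynomial σ B) (H : ∀ α, coeff (α + β) (g * r) ∈ J) (α : σ →₀ ℕ) :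
    coeff α r ∈ J := by
  classical
  induction hk : Finsupp.weight ν α using Nat.strong_induction_on generalizing α with
  | _ k ih =>
    have h1 := H α
    rw [coeff_mul, ← Finset.add_sum_erase _ _ (a := (β, α)) (by simp [add_comm])] at h1
    have h2 : ∑ x ∈ (Finset.HasAntidiagonal.antidiagonal (α + β)).erase (β, α), coeff x.1 g * coeff x.2 r ∈
        J := by
      refine Ideal.sum_mem _ fun x hx => ?_
      obtain ⟨hne, hx⟩ := Finset.mem_erase.1 hx
      rw [Finset.HasAntidiagonal.mem_antidiagonal] at hx
      by_cases h0 : coeff x.1 g = 0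
      · simp [h0]
      refine Ideal.mul_mem_left _ _ (ih _ ?_ x.2 rfl)
      have h3 : x.1 ≠ β := by
        intro h3
        refine hne (Prod.ext h3 ?_)
        rw [h3, add_comm] at hx
        exact add_right_cancel hx
      -- A first factor heavier than `β` forces the second to be lighter than `α`, where the
      -- induction applies.
      have h4 := hν x.1 (mem_support_iff.2 h0) h3
      have h5 := congrArg (Finsupp.weight ν) hx
      simp only [map_add] at h5
      omega
    have h3 := (Ideal.add_mem_iff_left _ h2).1 h1
    exact (Ideal.unit_mul_mem_iff_mem J hβ).1 h3

end UnitCoefficient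

/-! ### The weight filtration and initial forms -/

section WeightFiltration

variable {σ A B : Type*} [CommRing A] [CommRing B]

/-- The ideal generated by the monomials of weight at least `n` in the elements `y i`. -/
noncomputable def weightFiltration (w : σ → ℕ) (y : σ → A) (n : ℕ) : Ideal A :=
  Ideal.span ((fun α => eval y (monomial α 1)) '' {α | n ≤ Finsupp.weight w α})

variable {w : σ → ℕ} {y : σ → A}

theorem eval_monomial_mem_weightFiltration {n : ℕ} {α : σ →₀ ℕ} (h : n ≤ Finsupp.weight w α)
    (a : A) : eval y (monomial α a) ∈ weightFiltration w y n := by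
  rw [← mul_one a, ← smul_eq_mul, ← smul_monomial, smul_eval]
  exact Ideal.mul_mem_left _ _ (Ideal.subset_span ⟨α, h, rfl⟩)

theorem weightFiltration_anti {m n : ℕ} (h : m ≤ n) :
    weightFiltration w y n ≤ weightFiltration w y m :=
  Ideal.span_mono (Set.image_mono fun _ hα => h.trans hα)

theorem mul_mem_weightFiltration {i j : ℕ} {a b : A} (ha : a ∈ weightFiltration w y i)
    (hb : b ∈ weightFiltration w y j) : a * b ∈ weightFiltration w y (i + j) := by
  have h : weightFiltration w y i * weightFiltration w y j ≤ weightFiltration w y (i + j) := by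
    rw [weightFiltration, weightFiltration, Ideal.span_mul_span', Ideal.span_le]
    rintro _ ⟨_, ⟨α, hα, rfl⟩, _, ⟨β, hβ, rfl⟩, rfl⟩
    refine Ideal.subset_span ⟨α + β, ?_, ?_⟩
    · simpa using add_le_add hα hβ
    · simp only [← map_mul, monomial_mul, one_mul]
  exact h (Ideal.mul_mem_mul ha hb)

theorem mem_weightFiltration_zero (a : A) : a ∈ weightFiltration w y 0 := by
  simpa using eval_monomial_mem_weightFiltration (y := y) (Nat.zero_le (Finsupp.weight w 0)) a

theorem apply_mem_weightFiltration (i : σ) : y i ∈ weightFiltration w y (w i) := by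
  have h := eval_monomial_mem_weightFiltration (w := w) (y := y) (n := w i)
    (α := Finsupp.single i 1) (by simp [Finsupp.weight_single]) 1
  simpa [eval_monomial] using h

/-- This links ordinary powers, in which symbolic powers are defined, to the filtration. -/
theorem pow_span_le_weightFiltration (hw : ∀ i, 1 ≤ w i) (n : ℕ) :
    Ideal.span (Set.range y) ^ n ≤ weightFiltration w y n := by
  induction n with
  | zero => exact fun a _ => mem_weightFiltration_zero a
  | succ n ih =>
    rw [pow_succ, Ideal.mul_le]
    refine fun a ha b hb => mul_mem_weightFiltration (ih ha) ?_
    refine (Ideal.span_le.2 ?_ : Ideal.span (Set.range y) ≤ _) hb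
    rintro _ ⟨i, rfl⟩
    exact weightFiltration_anti (hw i) (apply_mem_weightFiltration i)

theorem eval_mem_weightFiltration {n : ℕ} {P : MvPolynomial σ A}
    (hP : P.IsWeightedHomogeneous w n) : eval y P ∈ weightFiltration w y n := by
  rw [P.as_sum, map_sum]
  exact Ideal.sum_mem _ fun α hα =>
    eval_monomial_mem_weightFiltration (hP (mem_support_iff.1 hα)).ge _

/-- Existence of initial forms: generators of weight exactly `n` contribute their monomial, heavier
ones contribute zero. -/
theorem exists_eval_sub_mem_weightFiltration {n : ℕ} {a : A} (ha : a ∈ weightFiltration w y n) :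
    ∃ P : MvPolynomial σ A, P.IsWeightedHomogeneous w n ∧
      a - eval y P ∈ weightFiltration w y (n + 1) := by
  induction ha using Submodule.span_induction with
  | mem a ha =>
    obtain ⟨α, hα, rfl⟩ := ha
    rcases (show n ≤ _ from hα).eq_or_lt with h | h
    · exact ⟨monomial α 1, isWeightedHomogeneous_monomial _ _ _ h.symm, by simp⟩
    · exact ⟨0, isWeightedHomogeneous_zero _ _ _, by
        simpa using eval_monomial_mem_weightFiltration (y := y) h 1⟩
  | zero => exact ⟨0, isWeightedHomogeneous_zero _ _ _, by simp⟩
  | add a b _ _ iha ihb =>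
    obtain ⟨P, hP, hPa⟩ := iha
    obtain ⟨Q, hQ, hQb⟩ := ihb
    refine ⟨P + Q, hP.add hQ, ?_⟩
    rw [map_add, add_sub_add_comm]
    exact add_mem hPa hQb
  | smul c a _ iha =>
    obtain ⟨P, hP, hPa⟩ := iha
    refine ⟨C c * P, hP.C_mul c, ?_⟩
    rw [map_mul, eval_C, smul_eq_mul, ← mul_sub]
    exact Ideal.mul_mem_left _ _ hPa

theorem MvPolynomial.IsWeightedHomogeneous.map_ringHom {n : ℕ} {P : MvPolynomial σ A}
    (hP : P.IsWeightedHomogeneous w n) (ρ : A →+* B) :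
    (MvPolynomial.map ρ P).IsWeightedHomogeneous w n := by
  intro α hα
  rw [coeff_map] at hα
  exact hP fun h => hα (by rw [h, map_zero])

/-- An arbitrary lift need not be homogeneous, but its component of weight `n` still maps to `p`. -/
theorem MvPolynomial.IsWeightedHomogeneous.exists_map_eq {ρ : A →+* B}
    (hρ : Function.Surjective ρ) {n : ℕ} {p : MvPolynomial σ B}
    (hp : p.IsWeightedHomogeneous w n) :
    ∃ P : MvPolynomial σ A, P.IsWeightedHomogeneous w n ∧ MvPolynomial.map ρ P = p := by
  classical
  obtain ⟨P, rfl⟩ := map_surjective ρ hρ p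
  refine ⟨weightedHomogeneousComponent w n P,
    weightedHomogeneousComponent_isWeightedHomogeneous n P, ?_⟩
  ext α
  rw [coeff_map, coeff_weightedHomogeneousComponent]
  split_ifs with h
  · rw [coeff_map]
  · rw [map_zero, hp.coeff_eq_zero α h]

/-- `p` is the initial form of degree `n` of `a` with respect to the weight filtration, with
coefficients in the image of `ρ`. -/
def IsSymbol (w : σ → ℕ) (y : σ → A) (ρ : A →+* B) (n : ℕ) (a : A) (p : MvPolynomial σ B) : Prop :=
  ∃ P : MvPolynomial σ A, P.IsWeightedHomogeneous w n ∧ MvPolynomial.map ρ P = p ∧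
    a - eval y P ∈ weightFiltration w y (n + 1)

/-- The elements `y i` are quasi-regular for the weights `w`: a weighted homogeneous polynomial
expression of degree `n` in them is of higher order only if its coefficients vanish under `ρ`. -/
def IsWeightedQuasiRegular (w : σ → ℕ) (y : σ → A) (ρ : A →+* B) : Prop :=
  ∀ (n : ℕ) (P : MvPolynomial σ A), P.IsWeightedHomogeneous w n →
    eval y P ∈ weightFiltration w y (n + 1) → MvPolynomial.map ρ P = 0

variable {ρ : A →+* B}

namespace IsSymbol

theorem isWeightedHomogeneous {n : ℕ} {a : A} {p : MvPolynomial σ B} (h : IsSymbol w y ρ n a p) :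
    p.IsWeightedHomogeneous w n := by
  obtain ⟨P, hP, rfl, -⟩ := h
  exact hP.map_ringHom ρ

theorem mem {n : ℕ} {a : A} {p : MvPolynomial σ B} (h : IsSymbol w y ρ n a p) :
    a ∈ weightFiltration w y n := by
  obtain ⟨P, hP, -, h⟩ := h
  have := add_mem (weightFiltration_anti n.le_succ h) (eval_mem_weightFiltration (y := y) hP)
  simpa using this

theorem exists_of_mem {n : ℕ} {a : A} (ha : a ∈ weightFiltration w y n) :
    ∃ p, IsSymbol w y ρ n a p := by
  obtain ⟨P, hP, h⟩ := exists_eval_sub_mem_weightFiltration ha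
  exact ⟨_, P, hP, rfl, h⟩

theorem eval_map {n : ℕ} {P : MvPolynomial σ A} (hP : P.IsWeightedHomogeneous w n) :
    IsSymbol w y ρ n (eval y P) (MvPolynomial.map ρ P) :=
  ⟨P, hP, rfl, by simp⟩

theorem exists_of_isWeightedHomogeneous (hρ : Function.Surjective ρ) {n : ℕ}
    {p : MvPolynomial σ B} (hp : p.IsWeightedHomogeneous w n) : ∃ a, IsSymbol w y ρ n a p := by
  obtain ⟨P, hP, rfl⟩ := hp.exists_map_eq hρ
  exact ⟨_, eval_map hP⟩

theorem of_mem_succ {n : ℕ} {a : A} (ha : a ∈ weightFiltration w y (n + 1)) :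
    IsSymbol w y ρ n a 0 :=
  ⟨0, isWeightedHomogeneous_zero _ _ _, by simp, by simpa using ha⟩

theorem C_apply (a : A) : IsSymbol w y ρ 0 a (C (ρ a)) :=
  ⟨C a, isWeightedHomogeneous_C _ _, by simp, by simp⟩

theorem X (i : σ) : IsSymbol w y ρ (w i) (y i) (X i) :=
  ⟨MvPolynomial.X i, isWeightedHomogeneous_X _ _ _, by simp, by simp⟩

theorem add {n : ℕ} {a b : A} {p q : MvPolynomial σ B} (ha : IsSymbol w y ρ n a p)
    (hb : IsSymbol w y ρ n b q) : IsSymbol w y ρ n (a + b) (p + q) := by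
  obtain ⟨P, hP, rfl, hPa⟩ := ha
  obtain ⟨Q, hQ, rfl, hQb⟩ := hb
  refine ⟨P + Q, hP.add hQ, by simp, ?_⟩
  rw [map_add, add_sub_add_comm]
  exact add_mem hPa hQb

theorem neg {n : ℕ} {a : A} {p : MvPolynomial σ B} (ha : IsSymbol w y ρ n a p) :
    IsSymbol w y ρ n (-a) (-p) := by
  obtain ⟨P, hP, rfl, hPa⟩ := ha
  refine ⟨-P, hP.neg, by simp, ?_⟩
  rw [map_neg, neg_sub_neg, ← neg_sub]
  exact neg_mem hPa

theorem sub {n : ℕ} {a b : A} {p q : MvPolynomial σ B} (ha : IsSymbol w y ρ n a p)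
    (hb : IsSymbol w y ρ n b q) : IsSymbol w y ρ n (a - b) (p - q) := by
  simpa only [sub_eq_add_neg] using ha.add hb.neg

theorem mul {i j : ℕ} {a b : A} {p q : MvPolynomial σ B} (ha : IsSymbol w y ρ i a p)
    (hb : IsSymbol w y ρ j b q) : IsSymbol w y ρ (i + j) (a * b) (p * q) := by
  have hb' := hb.mem
  obtain ⟨P, hP, rfl, hPa⟩ := ha
  obtain ⟨Q, hQ, rfl, hQb⟩ := hb
  refine ⟨P * Q, hP.mul hQ, by simp, ?_⟩
  have h1 := mul_mem_weightFiltration hPa hb'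
  have h2 := mul_mem_weightFiltration (eval_mem_weightFiltration (y := y) hP) hQb
  rw [add_right_comm] at h1
  have h3 : a * b - eval y (P * Q) =
      (a - eval y P) * b + eval y P * (b - eval y Q) := by rw [map_mul]; ring
  rw [h3]
  exact add_mem h1 h2

theorem pow {i : ℕ} {a : A} {p : MvPolynomial σ B} (ha : IsSymbol w y ρ i a p) (n : ℕ) :
    IsSymbol w y ρ (n * i) (a ^ n) (p ^ n) := by
  induction n with
  | zero => simpa using C_apply (w := w) (y := y) (ρ := ρ) 1
  | succ n ih => simpa only [pow_succ, Nat.succ_mul] using ih.mul ha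

/-- An initial form of degree `n` vanishes only if the element has order greater than `n`. -/
theorem mem_succ (hw : ∀ i, 1 ≤ w i) (hk : RingHom.ker ρ ≤ Ideal.span (Set.range y)) {n : ℕ}
    {a : A} (h : IsSymbol w y ρ n a 0) : a ∈ weightFiltration w y (n + 1) := by
  obtain ⟨P, hP, h0, hPa⟩ := h
  have h1 : eval y P ∈ weightFiltration w y (n + 1) := by
    rw [P.as_sum, map_sum]
    refine Ideal.sum_mem _ fun α hα => ?_
    -- A coefficient killed by `ρ` lies in the ideal of the `y i`, hence has order at least one,
    -- which raises the order of its term.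
    have h2 : coeff α P ∈ weightFiltration w y 1 := by
      refine pow_span_le_weightFiltration hw 1 ?_
      rw [pow_one]
      refine hk ?_
      rw [RingHom.mem_ker, ← coeff_map, h0, coeff_zero]
    have h3 := eval_monomial_mem_weightFiltration (y := y)
      (hP (mem_support_iff.1 hα)).ge 1
    have h4 := mul_mem_weightFiltration h3 h2
    rwa [mul_comm, ← smul_eval, smul_monomial, smul_eq_mul, mul_one] at h4
  simpa using add_mem hPa h1

theorem eq_zero (hq : IsWeightedQuasiRegular w y ρ) {n : ℕ} {a : A} {p : MvPolynomial σ B}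
    (h : IsSymbol w y ρ n a p) (ha : a ∈ weightFiltration w y (n + 1)) : p = 0 := by
  obtain ⟨P, hP, rfl, hPa⟩ := h
  refine hq n P hP ?_
  simpa using sub_mem ha hPa

theorem unique (hq : IsWeightedQuasiRegular w y ρ) {n : ℕ} {a : A} {p q : MvPolynomial σ B}
    (hp : IsSymbol w y ρ n a p) (hp' : IsSymbol w y ρ n a q) : p = q :=
  sub_eq_zero.1 ((hp.sub hp').eq_zero hq (by simp))

end IsSymbol

/-! ### Saturation of the filtration, with and without the equation -/

section Saturation

variable (hw : ∀ i, 1 ≤ w i) (hk : RingHom.ker ρ ≤ Ideal.span (Set.range y))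
  (hq : IsWeightedQuasiRegular w y ρ)

include hw hk hq

/-- The weight filtration is saturated with respect to the elements with nonzero image under `ρ`. -/
theorem mem_weightFiltration_of_mul_mem [IsDomain B] {s a : A} (hs : ρ s ≠ 0) {n : ℕ}
    (h : s * a ∈ weightFiltration w y n) : a ∈ weightFiltration w y n := by
  induction n with
  | zero => exact mem_weightFiltration_zero a
  | succ n ih =>
    obtain ⟨p, hp⟩ := IsSymbol.exists_of_mem (ρ := ρ) (ih (weightFiltration_anti n.le_succ h))
    have h1 := (IsSymbol.C_apply (w := w) (y := y) (ρ := ρ) s).mul hp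
    rw [zero_add] at h1
    have h2 := h1.eq_zero hq h
    rw [mul_eq_zero, C_eq_zero, or_iff_right hs] at h2
    subst h2
    exact hp.mem_succ hw hk

variable {d : ℕ} {h : A} {g : MvPolynomial σ B} (hg : IsSymbol w y ρ d h g)
  (hreg : ∀ r, g * r = 0 → r = 0)

include hg hreg

/-- Multiplication by `h` raises orders by exactly `d`: if `q` has initial form `r` in degree `k`
with `k + d < n`, then `g * r = 0`, so `r = 0` and `q` has higher order. -/
theorem mem_weightFiltration_of_mul_mem_of_add_le {q : A} {n : ℕ}
    (hhq : h * q ∈ weightFiltration w y n) (k : ℕ) (hkn : k + d ≤ n) :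
    q ∈ weightFiltration w y k := by
  induction k with
  | zero => exact mem_weightFiltration_zero q
  | succ k ih =>
    obtain ⟨r, hr⟩ := IsSymbol.exists_of_mem (ρ := ρ) (ih (by omega))
    have h1 := (hg.mul hr).eq_zero hq (weightFiltration_anti (by omega) hhq)
    rw [hreg r h1] at hr
    exact hr.mem_succ hw hk

/-- If `a` is of higher order modulo `h`, then its initial form is a multiple of that of `h`. -/
theorem IsSymbol.eq_zero_or_eq_mul {n : ℕ} {a : A} {p : MvPolynomial σ B}
    (hp : IsSymbol w y ρ n a p) (ha : a ∈ weightFiltration w y (n + 1) ⊔ Ideal.span {h}) :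
    p = 0 ∨ ∃ k r, n = d + k ∧ r.IsWeightedHomogeneous w k ∧ p = g * r := by
  obtain ⟨u, hu, v, hv, rfl⟩ := Submodule.mem_sup.1 ha
  obtain ⟨q, rfl⟩ := Ideal.mem_span_singleton'.1 hv
  rw [mul_comm q h] at hp
  rcases lt_or_ge n d with hnd | hnd
  · left
    refine hp.eq_zero hq (add_mem hu (Ideal.mul_mem_right _ _ ?_))
    exact weightFiltration_anti hnd hg.mem
  · obtain ⟨k, rfl⟩ := Nat.exists_eq_add_of_le hnd
    have h1 : h * q ∈ weightFiltration w y (d + k) := by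
      have := sub_mem hp.mem (weightFiltration_anti (d + k).le_succ hu)
      simpa using this
    have h2 := mem_weightFiltration_of_mul_mem_of_add_le hw hk hq hg hreg h1 k (by omega)
    obtain ⟨r, hr⟩ := IsSymbol.exists_of_mem (ρ := ρ) h2
    refine Or.inr ⟨k, r, rfl, hr.isWeightedHomogeneous, hp.unique hq ?_⟩
    simpa using (IsSymbol.of_mem_succ hu).add (hg.mul hr)

/-- If the initial form of `h` is regular modulo all nonzero elements of the base, then the sum of
a step of the weight filtration and of the ideal generated by `h` is saturated with respect to the
elements with nonzero image under `ρ`. -/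
theorem mem_weightFiltration_sup_of_mul_mem [IsDomain B] (hρ : Function.Surjective ρ) {s a : A}
    (hs : ρ s ≠ 0) (hsat : ∀ r p, g * r = C (ρ s) * p → C (ρ s) ∣ r) {n : ℕ}
    (ha : s * a ∈ weightFiltration w y n ⊔ Ideal.span {h}) :
    a ∈ weightFiltration w y n ⊔ Ideal.span {h} := by
  induction n with
  | zero => exact Submodule.mem_sup_left (mem_weightFiltration_zero a)
  | succ n ih =>
    have hs0 : (C (ρ s) : MvPolynomial σ B) ≠ 0 := by rwa [ne_eq, C_eq_zero]
    have h0 := ih ((sup_le_sup_right (weightFiltration_anti n.le_succ) (Ideal.span {h}) :) ha)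
    obtain ⟨a', ha', v, hv, rfl⟩ := Submodule.mem_sup.1 h0
    have hsa : s * a' ∈ weightFiltration w y (n + 1) ⊔ Ideal.span {h} := by
      rw [mul_add] at ha
      exact (Ideal.add_mem_iff_left _
        (Ideal.mul_mem_left _ _ (Submodule.mem_sup_right hv))).1 ha
    obtain ⟨p, hp⟩ := IsSymbol.exists_of_mem (ρ := ρ) ha'
    have h1 := (IsSymbol.C_apply (w := w) (y := y) (ρ := ρ) s).mul hp
    rw [zero_add] at h1
    refine add_mem ?_ (Submodule.mem_sup_right hv)
    rcases IsSymbol.eq_zero_or_eq_mul hw hk hq hg hreg h1 hsa with h2 | ⟨k, r, rfl, hr, h2⟩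
    · rw [mul_eq_zero, or_iff_right hs0] at h2
      subst h2
      exact Submodule.mem_sup_left (hp.mem_succ hw hk)
    -- Cancelling `ρ s` shows that `p` itself is a multiple `g * r'`. Subtracting `h` times a lift
    -- of `r'` then removes the initial form of `a'` without leaving its class modulo `h`.
    · obtain ⟨r', rfl⟩ := hsat r p h2.symm
      have h3 : p = g * r' := mul_left_cancel₀ hs0 (by rw [h2]; ring)
      have h4 : r'.IsWeightedHomogeneous w k := by
        intro α hα
        refine hr ?_
        rw [coeff_C_mul]
        exact mul_ne_zero hs hα
      obtain ⟨b, hb⟩ := IsSymbol.exists_of_isWeightedHomogeneous (y := y) hρ h4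
      have h5 := hp.sub (hg.mul hb)
      rw [h3, sub_self] at h5
      rw [← sub_add_cancel a' (h * b)]
      exact add_mem (Submodule.mem_sup_left (h5.mem_succ hw hk)) (Submodule.mem_sup_right
        (Ideal.mul_mem_right _ _ (Ideal.mem_span_singleton_self h)))

end Saturation

end WeightFiltration

/-! ### Evaluating polynomials at classes in the graded algebra -/

section SymbolicPowers

variable {R : Type*} [CommRing R] {I : Ideal R}

theorem symbolicPower_anti {m n : ℕ} (h : m ≤ n) : symbolicPower I n ≤ symbolicPower I m :=
  fun _ ⟨s, hs, hsa⟩ => ⟨s, hs, Ideal.pow_le_pow_right h hsa⟩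

namespace GrAlgebra

theorem cls_congr {m n : ℕ} {a b : R} (hmn : m = n) (hab : a = b) (ha : a ∈ symbolicPower I m)
    (hb : b ∈ symbolicPower I n) : cls m a ha = cls n b hb := by
  subst hmn hab
  rfl

theorem cls_add {n : ℕ} {a b : R} (ha : a ∈ symbolicPower I n) (hb : b ∈ symbolicPower I n) :
    cls n a ha + cls n b hb = cls n (a + b) (add_mem ha hb) := by
  rw [cls, cls, ← map_add]
  rfl

theorem cls_mul {i j : ℕ} {a b : R} (ha : a ∈ symbolicPower I i) (hb : b ∈ symbolicPower I j) :
    cls i a ha * cls j b hb = cls (i + j) (a * b) (mul_mem_symbolicPower ha hb) := by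
  rw [cls, cls, DirectSum.of_mul_of]
  rfl

theorem cls_eq_zero_iff {n : ℕ} {a : R} (ha : a ∈ symbolicPower I n) :
    cls n a ha = 0 ↔ a ∈ symbolicPower I (n + 1) := by
  rw [cls, ← map_zero (DirectSum.of (GrPiece I) n), (DirectSum.of_injective n).eq_iff,
    GrPiece.mk_eq_zero_iff]

theorem cls_eq_of_sub_mem {n : ℕ} {a b : R} (ha : a ∈ symbolicPower I n)
    (hb : b ∈ symbolicPower I n) (h : a - b ∈ symbolicPower I (n + 1)) :
    cls n a ha = cls n b hb := by
  have h1 := cls_add (sub_mem ha hb) hb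
  rw [(cls_eq_zero_iff _).2 h, zero_add] at h1
  exact (h1.trans (cls_congr rfl (by ring) _ _)).symm

theorem algebraMap_mk (r : R) :
    algebraMap (R ⧸ I) (GrAlgebra I) (Ideal.Quotient.mk I r) =
      cls 0 r (GrPiece.mem_symbolicPower_zero r) := by
  rw [DirectSum.algebraMap_apply]
  refine congrArg (DirectSum.of (GrPiece I) 0) ?_
  change GrPiece.mk 0 (r * 1) _ = GrPiece.mk 0 r _
  simp only [mul_one]

variable {σ : Type*} {w : σ → ℕ} {y : σ → R} (hy : ∀ i, y i ∈ symbolicPower I (w i))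

/-- The evaluation of polynomials over `R ⧸ I` at the classes of elements `y i ∈ I⁽ʷⁱ⁾`. -/
noncomputable def evalCls : MvPolynomial σ (R ⧸ I) →ₐ[R ⧸ I] GrAlgebra I :=
  aeval fun i => cls (w i) (y i) (hy i)

theorem evalCls_X (i : σ) : evalCls hy (X i) = cls (w i) (y i) (hy i) := aeval_X _ _

/-- `p` is evaluated to the class of `a` in degree `n`. -/
def EvalsTo (p : MvPolynomial σ (R ⧸ I)) (n : ℕ) (a : R) : Prop :=
  ∃ h : a ∈ symbolicPower I n, evalCls hy p = cls n a h

variable {hy}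

theorem EvalsTo.mul {p q : MvPolynomial σ (R ⧸ I)} {m n : ℕ} {a b : R} (hp : EvalsTo hy p m a)
    (hq : EvalsTo hy q n b) : EvalsTo hy (p * q) (m + n) (a * b) := by
  obtain ⟨ha, hp⟩ := hp
  obtain ⟨hb, hq⟩ := hq
  exact ⟨mul_mem_symbolicPower ha hb, by rw [map_mul, hp, hq, cls_mul]⟩

theorem EvalsTo.add {p q : MvPolynomial σ (R ⧸ I)} {n : ℕ} {a b : R} (hp : EvalsTo hy p n a)
    (hq : EvalsTo hy q n b) : EvalsTo hy (p + q) n (a + b) := by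
  obtain ⟨ha, hp⟩ := hp
  obtain ⟨hb, hq⟩ := hq
  exact ⟨add_mem ha hb, by rw [map_add, hp, hq, cls_add]⟩

theorem EvalsTo.of_sub_mem {p : MvPolynomial σ (R ⧸ I)} {n : ℕ} {a b : R} (hp : EvalsTo hy p n a)
    (h : b - a ∈ symbolicPower I (n + 1)) : EvalsTo hy p n b := by
  obtain ⟨ha, hp⟩ := hp
  have hb : b ∈ symbolicPower I n := by
    simpa using add_mem (symbolicPower_anti n.le_succ h) ha
  exact ⟨hb, by rw [hp, cls_eq_of_sub_mem hb ha h]⟩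

theorem evalsTo_C (r : R) : EvalsTo hy (C (Ideal.Quotient.mk I r)) 0 r := by
  refine ⟨GrPiece.mem_symbolicPower_zero r, ?_⟩
  rw [← algebraMap_mk, ← algebraMap_eq, AlgHom.commutes]

theorem evalsTo_X (i : σ) : EvalsTo hy (X i) (w i) (y i) := ⟨hy i, evalCls_X hy i⟩

theorem evalsTo_monomial (α : σ →₀ ℕ) (a : R) :
    EvalsTo hy (monomial α (Ideal.Quotient.mk I a)) (Finsupp.weight w α)
      (eval y (monomial α a)) := by
  have hzero (a : R) : EvalsTo hy (monomial 0 (Ideal.Quotient.mk I a)) (Finsupp.weight w (0 : σ →₀ ℕ))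
      (eval y (monomial 0 a)) := by
    rw [map_zero, monomial_zero', monomial_zero', eval_C]
    exact evalsTo_C a
  have hadd {α β : σ →₀ ℕ} {a : R} (h₁ : EvalsTo hy (monomial α (Ideal.Quotient.mk I a))
      (Finsupp.weight w α) (eval y (monomial α a)))
      (h₂ : EvalsTo hy (monomial β (Ideal.Quotient.mk I 1)) (Finsupp.weight w β)
        (eval y (monomial β 1))) :
      EvalsTo hy (monomial (α + β) (Ideal.Quotient.mk I a)) (Finsupp.weight w (α + β))
        (eval y (monomial (α + β) a)) := by
    have := h₁.mul h₂
    rwa [← map_mul, monomial_mul, monomial_mul, ← map_mul, ← map_add, mul_one] at this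
  induction α using Finsupp.induction_linear generalizing a with
  | zero => exact hzero a
  | add α β ihα ihβ => exact hadd (ihα a) (ihβ 1)
  | single i n =>
    induction n with
    | zero => rw [Finsupp.single_zero]; exact hzero a
    | succ n ih =>
      rw [Finsupp.single_add]
      refine hadd ih ?_
      have h := evalsTo_X (hy := hy) i
      rw [map_one, Finsupp.weight_single, smul_eq_mul, one_mul]
      simpa [X, eval_monomial] using h

theorem evalsTo_map {n : ℕ} {P : MvPolynomial σ R} (hP : P.IsWeightedHomogeneous w n) :
    EvalsTo hy (map (Ideal.Quotient.mk I) P) n (eval y P) := by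
  induction hP using IsWeightedHomogeneous.induction_on with
  | zero =>
    rw [map_zero, map_zero]
    exact ⟨zero_mem _, by rw [map_zero, eq_comm, cls_eq_zero_iff]; exact zero_mem _⟩
  | add P Q _ _ ihP ihQ =>
    rw [map_add, map_add]
    exact ihP.add ihQ
  | monomial α a hα =>
    subst hα
    rw [map_monomial]
    exact evalsTo_monomial α a

variable {A : Type*} [CommRing A] {π : A →+* R} {z : σ → A}

/-- The easy comparison: products of elements of symbolic powers lie in the symbolic power of the
summed degree. -/
theorem weightFiltration_le_comap_symbolicPower (hz : ∀ i, π (z i) ∈ symbolicPower I (w i))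
    (n : ℕ) : weightFiltration w z n ≤ (symbolicPower I n).comap π := by
  refine Ideal.span_le.2 ?_
  rintro _ ⟨α, hα, rfl⟩
  obtain ⟨h, -⟩ := evalsTo_monomial (hy := hz) α 1
  refine symbolicPower_anti hα ?_
  rw [map_eval, map_monomial, map_one]
  exact h

/-- The initial form of `a` is evaluated to the class of `a`. -/
theorem _root_.IsSymbol.evalsTo {hz : ∀ i, π (z i) ∈ symbolicPower I (w i)} {n : ℕ} {a : A}
    {p : MvPolynomial σ (R ⧸ I)} (hp : IsSymbol w z ((Ideal.Quotient.mk I).comp π) n a p) :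
    EvalsTo hz p n (π a) := by
  obtain ⟨P, hP, rfl, h⟩ := hp
  have h1 := evalsTo_map (hy := hz) (hP.map_ringHom π)
  rw [map_map] at h1
  refine h1.of_sub_mem ?_
  have h2 := weightFiltration_le_comap_symbolicPower hz _ h
  rwa [Ideal.mem_comap, map_sub, map_eval] at h2

section Presentation

variable {h : A}

/-- By `hn` a class is represented by an element of the filtration, the multiple of `h` being
invisible under `π`; the initial form of that element evaluates to the class. -/
theorem exists_evalCls_eq (hπ : Function.Surjective π) (hh : π h = 0)
    (hz : ∀ i, π (z i) ∈ symbolicPower I (w i)) {n : ℕ}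
    (hn : (symbolicPower I n).comap π ≤ weightFiltration w z n ⊔ Ideal.span {h})
    (x : GrPiece I n) : ∃ p : MvPolynomial σ (R ⧸ I), p.IsWeightedHomogeneous w n ∧
      evalCls hz p = DirectSum.of (GrPiece I) n x := by
  obtain ⟨r, hr, rfl⟩ := GrPiece.exists_mk x
  obtain ⟨a, rfl⟩ := hπ r
  obtain ⟨u, hu, v, hv, huv⟩ := Submodule.mem_sup.1 (hn hr)
  obtain ⟨q, rfl⟩ := Ideal.mem_span_singleton'.1 hv
  obtain ⟨p, hp⟩ := IsSymbol.exists_of_mem (ρ := (Ideal.Quotient.mk I).comp π) hu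
  obtain ⟨h1, h2⟩ := hp.evalsTo (hz := hz)
  refine ⟨p, hp.isWeightedHomogeneous, h2.trans (cls_congr rfl ?_ _ _)⟩
  rw [← huv, map_add, map_mul, hh, mul_zero, add_zero]

/-- Turns a relation between classes into a statement about initial forms: any lift of `p` has image
in the next symbolic power, so `hn` places it in higher order modulo `h`. -/
theorem exists_isSymbol_of_evalCls_eq_zero (hπ : Function.Surjective π)
    (hz : ∀ i, π (z i) ∈ symbolicPower I (w i)) {n : ℕ}
    (hn : (symbolicPower I (n + 1)).comap π ≤ weightFiltration w z (n + 1) ⊔ Ideal.span {h})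
    {p : MvPolynomial σ (R ⧸ I)} (hp : p.IsWeightedHomogeneous w n) (h0 : evalCls hz p = 0) :
    ∃ a ∈ weightFiltration w z (n + 1) ⊔ Ideal.span {h},
      IsSymbol w z ((Ideal.Quotient.mk I).comp π) n a p := by
  obtain ⟨a, ha⟩ := IsSymbol.exists_of_isWeightedHomogeneous (y := z)
    (ρ := (Ideal.Quotient.mk I).comp π) (Ideal.Quotient.mk_surjective.comp hπ) hp
  obtain ⟨h1, h2⟩ := ha.evalsTo (hz := hz)
  rw [h0, eq_comm, cls_eq_zero_iff] at h2
  exact ⟨a, hn h2, ha⟩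

theorem exists_of_eq_evalCls (hy : ∀ i, y i ∈ symbolicPower I (w i)) {n : ℕ}
    {p : MvPolynomial σ (R ⧸ I)} (hp : p.IsWeightedHomogeneous w n) :
    ∃ x, evalCls hy p = DirectSum.of (GrPiece I) n x := by
  obtain ⟨P, hP, rfl⟩ := hp.exists_map_eq Ideal.Quotient.mk_surjective
  obtain ⟨h1, h2⟩ := evalsTo_map (hy := hy) hP
  exact ⟨_, h2⟩

theorem evalCls_surjective (hy : ∀ i, y i ∈ symbolicPower I (w i))
    (H : ∀ n (x : GrPiece I n), ∃ p : MvPolynomial σ (R ⧸ I), p.IsWeightedHomogeneous w n ∧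
      evalCls hy p = DirectSum.of (GrPiece I) n x) : Function.Surjective (evalCls hy) := by
  intro x
  induction x using DirectSum.induction_on with
  | zero => exact ⟨0, map_zero _⟩
  | of n x =>
    obtain ⟨p, -, hp⟩ := H n x
    exact ⟨p, hp⟩
  | add x x' hx hx' =>
    obtain ⟨p, rfl⟩ := hx
    obtain ⟨q, rfl⟩ := hx'
    exact ⟨p + q, map_add _ _ _⟩

/-- The homogeneous components of `p` land in different summands, so each of them is killed
separately; only homogeneous relations need to be studied. -/
theorem dvd_of_evalCls_eq_zero (hy : ∀ i, y i ∈ symbolicPower I (w i))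
    {g : MvPolynomial σ (R ⧸ I)}
    (H : ∀ n (p : MvPolynomial σ (R ⧸ I)), p.IsWeightedHomogeneous w n → evalCls hy p = 0 → g ∣ p)
    {p : MvPolynomial σ (R ⧸ I)} (hp : evalCls hy p = 0) : g ∣ p := by
  choose c hc using fun n => exists_of_eq_evalCls hy
    (weightedHomogeneousComponent_isWeightedHomogeneous (w := w) n p)
  have hfin := weightedHomogeneousComponent_finsupp (w := w) p
  have hsum := sum_weightedHomogeneousComponent w p
  rw [finsum_eq_sum _ hfin] at hsum
  rw [← hsum]
  refine Finset.dvd_sum fun n hn => H n _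
    (weightedHomogeneousComponent_isWeightedHomogeneous n p) ?_
  have h1 : ∑ k ∈ Set.Finite.toFinset hfin, DirectSum.of (GrPiece I) k (c k) = 0 := by
    rw [← hp, ← congrArg (evalCls hy) hsum, map_sum]
    exact Finset.sum_congr rfl fun k _ => (hc k).symm
  have h2 := congrArg (fun x : GrAlgebra I => x n) h1
  simp only [DirectSum.sum_apply, DirectSum.zero_apply] at h2
  rw [Finset.sum_eq_single_of_mem n hn fun k _ hk => DirectSum.of_eq_of_ne _ _ _ hk.symm,
    DirectSum.of_eq_same] at h2
  rw [hc, h2, map_zero]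

end Presentation

end GrAlgebra

end SymbolicPowers

/-! ### Convergent power series along the x₁-axis -/

namespace ConvSeries

/-- The inclusion of the convergent power series in the formal ones. -/
noncomputable def toFormal (k : ℕ) : ConvSeries k →+* MvPowerSeries (Fin k) ℂ :=
  (convSubalgebra k).val.toRingHom

theorem toFormal_injective {k : ℕ} : Function.Injective (toFormal k) := Subtype.val_injective

theorem toFormal_x {k : ℕ} (i : Fin k) : toFormal k (x i) = MvPowerSeries.X i := rfl

theorem toFormal_bound {k : ℕ} (f : ConvSeries k) : ∃ A r : ℝ, 0 < r ∧ ∀ n : Fin k →₀ ℕ,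
    ‖MvPowerSeries.coeff n (toFormal k f)‖ ≤ A * r ^ Finsupp.degree n := f.2

theorem exists_toFormal_eq {k : ℕ} {f : MvPowerSeries (Fin k) ℂ} (h : ∃ A r : ℝ, 0 < r ∧
    ∀ n : Fin k →₀ ℕ, ‖MvPowerSeries.coeff n f‖ ≤ A * r ^ Finsupp.degree n) :
    ∃ g : ConvSeries k, toFormal k g = f := ⟨⟨f, h⟩, rfl⟩

open Classical in
/-- The part of a convergent power series formed by a set of monomials divisible by `x i` is a
multiple of `x i`. -/
theorem exists_coeff_x_mul {k : ℕ} (i : Fin k) (S : Set (Fin k →₀ ℕ)) (hS : ∀ n ∈ S, 1 ≤ n i)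
    (f : ConvSeries k) : ∃ g : ConvSeries k, ∀ n,
      MvPowerSeries.coeff n (toFormal k (x i * g)) =
        if n ∈ S then MvPowerSeries.coeff n (toFormal k f) else 0 := by
  obtain ⟨A, r, hr, hf⟩ := toFormal_bound f
  have hA : 0 ≤ A := by simpa using (norm_nonneg _).trans (hf 0)
  let g₀ : MvPowerSeries (Fin k) ℂ := fun n =>
    if n + Finsupp.single i 1 ∈ S then
      MvPowerSeries.coeff (n + Finsupp.single i 1) (toFormal k f) else 0
  have hg₀ (n) : MvPowerSeries.coeff n g₀ = if n + Finsupp.single i 1 ∈ S then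
      MvPowerSeries.coeff (n + Finsupp.single i 1) (toFormal k f) else 0 := rfl
  -- Dividing by `x i` shifts the exponent by one, which costs one factor `r` in the bound.
  obtain ⟨g, hg⟩ := exists_toFormal_eq (f := g₀) ⟨A * r, r, hr, fun n => by
    rw [hg₀]
    split_ifs
    · refine (hf _).trans_eq ?_
      rw [map_add, Finsupp.degree_single, pow_succ]
      ring
    · rw [norm_zero]
      positivity⟩
  refine ⟨g, fun n => ?_⟩
  rw [map_mul, toFormal_x, hg, MvPowerSeries.X_def, MvPowerSeries.coeff_monomial_mul, one_mul, hg₀]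
  by_cases hn : n ∈ S
  · have h1 : Finsupp.single i 1 ≤ n := by
      rw [Finsupp.single_le_iff]
      exact hS n hn
    rw [if_pos h1, tsub_add_cancel_of_le h1]
  · rw [if_neg hn]
    split_ifs with h1 h2
    · rw [tsub_add_cancel_of_le h1] at h2
      exact absurd h2 hn
    · rfl
    · rfl

/-- The restriction of a power series to the `x₁`-axis. -/
noncomputable def formalRestrict (k : ℕ) : MvPowerSeries (Fin (k + 1)) ℂ →+* PowerSeries ℂ where
  toFun f := PowerSeries.mk fun n => MvPowerSeries.coeff (Finsupp.single 0 n) f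
  map_one' := by
    classical
    ext n
    rw [PowerSeries.coeff_mk, MvPowerSeries.coeff_one, PowerSeries.coeff_one]
    simp only [Finsupp.single_eq_zero]
  map_mul' f g := by
    classical
    ext n
    rw [PowerSeries.coeff_mk, MvPowerSeries.coeff_mul, PowerSeries.coeff_mul,
      Finsupp.antidiagonal_single, Finset.sum_map]
    simp
  map_zero' := by ext n; simp
  map_add' f g := by ext n; simp

theorem coeff_formalRestrict {k : ℕ} (f : MvPowerSeries (Fin (k + 1)) ℂ) (n : ℕ) :
    PowerSeries.coeff n (formalRestrict k f) = MvPowerSeries.coeff (Finsupp.single 0 n) f :=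
  PowerSeries.coeff_mk n fun n => MvPowerSeries.coeff (Finsupp.single 0 n) f

/-- The transversal coordinates `x₂, x₃, x₄`. -/
noncomputable def normal (i : Fin 3) : ConvSeries 4 := x i.succ

/-- The ideal of the `x₁`-axis consists of the series which vanish on it. -/
theorem span_normal_eq_ker :
    Ideal.span (Set.range normal) = RingHom.ker ((formalRestrict 3).comp (toFormal 4)) := by
  classical
  refine le_antisymm ?_ ?_
  · rw [Ideal.span_le]
    rintro _ ⟨i, rfl⟩
    rw [SetLike.mem_coe, RingHom.mem_ker]
    ext n
    rw [RingHom.comp_apply, coeff_formalRestrict, normal, toFormal_x, MvPowerSeries.coeff_X,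
      if_neg, map_zero]
    intro h
    have := DFunLike.congr_fun h i.succ
    simp at this
  · intro f hf
    have hf' (n : ℕ) : MvPowerSeries.coeff (Finsupp.single 0 n) (toFormal 4 f) = 0 := by
      rw [← coeff_formalRestrict]
      rw [RingHom.mem_ker, RingHom.comp_apply] at hf
      rw [hf, map_zero]
    -- The monomials off the axis are sorted by the first of x₂, x₃, x₄ dividing them, so the three
    -- parts are disjoint.
    obtain ⟨g₁, hg₁⟩ := exists_coeff_x_mul 1 {n | 1 ≤ n 1} (fun n hn => hn) f
    obtain ⟨g₂, hg₂⟩ := exists_coeff_x_mul 2 {n | n 1 = 0 ∧ 1 ≤ n 2} (fun n hn => hn.2) f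
    obtain ⟨g₃, hg₃⟩ := exists_coeff_x_mul 3 {n | n 1 = 0 ∧ n 2 = 0 ∧ 1 ≤ n 3}
      (fun n hn => hn.2.2) f
    have h : f = x 1 * g₁ + x 2 * g₂ + x 3 * g₃ := by
      refine toFormal_injective (MvPowerSeries.ext fun n => ?_)
      rw [map_add, map_add, map_add, map_add, hg₁, hg₂, hg₃]
      simp only [Set.mem_ofPred_eq]
      by_cases h1 : n 1 = 0
      · by_cases h2 : n 2 = 0
        · by_cases h3 : n 3 = 0
          · have hn : n = Finsupp.single 0 (n 0) := by
              ext i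
              fin_cases i <;> simp [h1, h2, h3]
            rw [hn, hf']
            simp
          · simp [h1, h2, Nat.one_le_iff_ne_zero, h3]
        · simp [h1, h2, Nat.one_le_iff_ne_zero]
      · simp [h1, Nat.one_le_iff_ne_zero]
    rw [h]
    exact add_mem (add_mem (Ideal.mul_mem_right _ _ (Ideal.subset_span ⟨0, rfl⟩))
      (Ideal.mul_mem_right _ _ (Ideal.subset_span ⟨1, rfl⟩)))
      (Ideal.mul_mem_right _ _ (Ideal.subset_span ⟨2, rfl⟩))

theorem isPrime_span_normal : (Ideal.span (Set.range normal)).IsPrime := by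
  rw [span_normal_eq_ker]
  exact RingHom.ker_isPrime _

theorem toFormal_eval_monomial (α : Fin 3 →₀ ℕ) :
    toFormal 4 (MvPolynomial.eval normal (MvPolynomial.monomial α 1)) =
      MvPowerSeries.monomial (α.mapDomain Fin.succ) 1 := by
  have hzero : toFormal 4 (MvPolynomial.eval normal (MvPolynomial.monomial 0 1)) =
      MvPowerSeries.monomial (Finsupp.mapDomain Fin.succ 0) 1 := by
    simp [Finsupp.mapDomain_zero]
  have hadd {α β : Fin 3 →₀ ℕ}
      (hα : toFormal 4 (MvPolynomial.eval normal (MvPolynomial.monomial α 1)) =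
        MvPowerSeries.monomial (α.mapDomain Fin.succ) 1)
      (hβ : toFormal 4 (MvPolynomial.eval normal (MvPolynomial.monomial β 1)) =
        MvPowerSeries.monomial (β.mapDomain Fin.succ) 1) :
      toFormal 4 (MvPolynomial.eval normal (MvPolynomial.monomial (α + β) 1)) =
        MvPowerSeries.monomial ((α + β).mapDomain Fin.succ) 1 := by
    rw [Finsupp.mapDomain_add, ← one_mul (1 : ℂ), ← MvPowerSeries.monomial_mul_monomial, ← hα,
      ← hβ, ← map_mul, ← map_mul, MvPolynomial.monomial_mul, one_mul]
  induction α using Finsupp.induction_linear with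
  | zero => exact hzero
  | add α β ihα ihβ => exact hadd ihα ihβ
  | single i n =>
    induction n with
    | zero => rw [Finsupp.single_zero]; exact hzero
    | succ n ih =>
      rw [Finsupp.single_add]
      refine hadd ih ?_
      rw [Finsupp.mapDomain_single, ← MvPowerSeries.X_def, ← toFormal_x]
      simp [normal, MvPolynomial.eval_monomial]

theorem weight_cons_mapDomain_succ (w : Fin 3 → ℕ) (α : Fin 3 →₀ ℕ) :
    Finsupp.weight (Fin.cons 0 w : Fin 4 → ℕ) (α.mapDomain Fin.succ) = Finsupp.weight w α := by
  rw [Finsupp.weight_apply, Finsupp.weight_apply, Finsupp.sum_mapDomain_index_inj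
    (Fin.succ_injective 3)]
  simp

/-- With x₁ given weight zero, multiplying by an arbitrary series never lowers the weight of a
monomial. -/
theorem coeff_eq_zero_of_mem_weightFiltration {w : Fin 3 → ℕ} {n : ℕ} {f : ConvSeries 4}
    (hf : f ∈ weightFiltration w normal n) (m : Fin 4 →₀ ℕ)
    (hm : Finsupp.weight (Fin.cons 0 w : Fin 4 → ℕ) m < n) :
    MvPowerSeries.coeff m (toFormal 4 f) = 0 := by
  classical
  induction hf using Submodule.span_induction generalizing m with
  | mem f hf =>
    obtain ⟨α, hα, rfl⟩ := hf
    rw [toFormal_eval_monomial, MvPowerSeries.coeff_monomial, if_neg]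
    rintro rfl
    rw [weight_cons_mapDomain_succ] at hm
    exact (hm.trans_le hα).false
  | zero => simp
  | add f g _ _ ihf ihg => rw [map_add, map_add, ihf m hm, ihg m hm, add_zero]
  | smul c f _ ih =>
    rw [smul_eq_mul, map_mul, MvPowerSeries.coeff_mul]
    refine Finset.sum_eq_zero fun p hp => ?_
    rw [Finset.HasAntidiagonal.mem_antidiagonal] at hp
    rw [ih p.2 (lt_of_le_of_lt ?_ hm), mul_zero]
    rw [← hp, map_add]
    exact Nat.le_add_left _ _

/-- Compare coefficients at x₁ᵏ times the monomial of exponent α. A term of exponent β contributes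
only if β ≤ α; as both have weight `n` and all weights are positive, β = α. So the coefficient of
`P` at α vanishes on the axis. -/
theorem isWeightedQuasiRegular_normal {B : Type*} [CommRing B] {w : Fin 3 → ℕ}
    (hw : ∀ i, 1 ≤ w i) {ρ : ConvSeries 4 →+* B}
    (hρ : Ideal.span (Set.range normal) ≤ RingHom.ker ρ) :
    IsWeightedQuasiRegular w normal ρ := by
  classical
  intro n P hP hmem
  ext α
  rw [MvPolynomial.coeff_map, MvPolynomial.coeff_zero]
  by_cases hα : MvPolynomial.coeff α P = 0
  · rw [hα, map_zero]
  refine hρ ?_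
  rw [span_normal_eq_ker, RingHom.mem_ker]
  ext k
  rw [RingHom.comp_apply, coeff_formalRestrict, map_zero]
  have h1 := coeff_eq_zero_of_mem_weightFiltration hmem
    (Finsupp.single 0 k + α.mapDomain Fin.succ) (by
      rw [map_add, weight_cons_mapDomain_succ, hP hα, Finsupp.weight_single]
      simp)
  have hterm (β : Fin 3 →₀ ℕ) :
      toFormal 4 (MvPolynomial.eval normal (MvPolynomial.monomial β (MvPolynomial.coeff β P))) =
        MvPowerSeries.monomial (β.mapDomain Fin.succ) 1 *
          toFormal 4 (MvPolynomial.coeff β P) := by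
    rw [← toFormal_eval_monomial, ← map_mul, mul_comm, ← MvPolynomial.smul_eval,
      MvPolynomial.smul_monomial, smul_eq_mul, mul_one]
  rw [P.as_sum, map_sum, map_sum, map_sum, Finset.sum_eq_single_of_mem α
    (MvPolynomial.mem_support_iff.2 hα)] at h1
  · rw [hterm, MvPowerSeries.coeff_monomial_mul, if_pos le_add_self, add_tsub_cancel_right,
      one_mul] at h1
    exact h1
  · intro β hβ hne
    rw [hterm, MvPowerSeries.coeff_monomial_mul, if_neg]
    intro hle
    have hle' : β ≤ α := by
      intro i
      have h2 := hle i.succ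
      rw [Finsupp.add_apply, Finsupp.mapDomain_apply (Fin.succ_injective 3),
        Finsupp.mapDomain_apply (Fin.succ_injective 3), Finsupp.single_eq_of_ne
        (Fin.succ_ne_zero i), zero_add] at h2
      exact h2
    obtain ⟨γ, rfl⟩ := exists_add_of_le hle'
    have h3 := (hP hα).trans (hP (MvPolynomial.mem_support_iff.1 hβ)).symm
    rw [map_add, add_eq_left] at h3
    refine hne ?_
    rw [left_eq_add]
    ext i
    rw [Finsupp.weight_apply, Finsupp.sum_fintype _ _ (by simp), Finset.sum_eq_zero_iff] at h3
    have h4 := h3 i (Finset.mem_univ i)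
    rw [smul_eq_mul, mul_eq_zero] at h4
    exact h4.resolve_right (Nat.one_le_iff_ne_zero.1 (hw i))

end ConvSeries

/-! ### Regularity of weighted quadrics -/

section WeightedQuadric

variable {B : Type*} [CommRing B]

/-- The polynomial `τ x₄ + a x₂² + b x₂ x₃ + c x₃²`, with the variables numbered `x₂ = X 0`,
`x₃ = X 1`, `x₄ = X 2`. -/
noncomputable def weightedQuadric (τ a b c : B) : MvPolynomial (Fin 3) B :=
  C τ * X 2 + (C a * X 0 ^ 2 + C b * (X 0 * X 1) + C c * X 1 ^ 2)

variable {τ a b c : B}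

theorem weightedQuadric_eq_monomial : weightedQuadric τ a b c =
    monomial (Finsupp.single 2 1) τ + (monomial (Finsupp.single 0 2) a +
      monomial (Finsupp.single 0 1 + Finsupp.single 1 1) b + monomial (Finsupp.single 1 2) c) := by
  simp only [weightedQuadric, C_mul_X_eq_monomial, C_mul_X_pow_eq_monomial]
  rw [X, X, monomial_mul, C_mul_monomial]
  simp

theorem mem_support_weightedQuadric {x : Fin 3 →₀ ℕ}
    (hx : x ∈ (weightedQuadric τ a b c).support) :
    (x = Finsupp.single 2 1 ∧ τ ≠ 0) ∨ (x = Finsupp.single 0 2 ∧ a ≠ 0) ∨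
      (x = Finsupp.single 0 1 + Finsupp.single 1 1 ∧ b ≠ 0) ∨ (x = Finsupp.single 1 2 ∧ c ≠ 0) := by
  classical
  rw [mem_support_iff, weightedQuadric_eq_monomial] at hx
  contrapose! hx
  obtain ⟨h1, h2, h3, h4⟩ := hx
  simp only [coeff_add, coeff_monomial]
  rw [ite_eq_right_iff.2 fun h => h1 h.symm, ite_eq_right_iff.2 fun h => h2 h.symm,
    ite_eq_right_iff.2 fun h => h3 h.symm, ite_eq_right_iff.2 fun h => h4 h.symm]
  simp

theorem single_add_single_ne (i : Fin 3) (n : ℕ) :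
    (Finsupp.single 0 1 + Finsupp.single 1 1 : Fin 3 →₀ ℕ) ≠ Finsupp.single i n := by
  intro h
  have h0 := DFunLike.congr_fun h 0
  have h1 := DFunLike.congr_fun h 1
  fin_cases i <;> simp at h0 h1

theorem coeff_weightedQuadric_zero :
    coeff (Finsupp.single 0 2) (weightedQuadric τ a b c) = a := by
  classical
  simp [weightedQuadric_eq_monomial, coeff_monomial, single_add_single_ne,
    Finsupp.single_eq_single_iff]

theorem coeff_weightedQuadric_one :
    coeff (Finsupp.single 1 2) (weightedQuadric τ a b c) = c := by
  classical
  simp [weightedQuadric_eq_monomial, coeff_monomial, single_add_single_ne,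
    Finsupp.single_eq_single_iff]

theorem coeff_weightedQuadric_add :
    coeff (Finsupp.single 0 1 + Finsupp.single 1 1) (weightedQuadric τ a b c) = b := by
  classical
  simp [weightedQuadric_eq_monomial, coeff_monomial, (single_add_single_ne _ _).symm]

/-- A weighted quadric with a unit as coefficient of `x₃²` divides no nonzero polynomial of degree
at most one in `x₃`. -/
theorem eq_zero_of_coeff_weightedQuadric_mul_of_isUnit_right (hc : IsUnit c)
    {r : MvPolynomial (Fin 3) B}
    (H : ∀ α, coeff (α + Finsupp.single 1 2) (weightedQuadric τ a b c * r) = 0) : r = 0 := by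
  ext α
  -- Giving x₃ weight zero makes x₃² the only monomial of weight zero.
  refine coeff_mem_of_coeff_mul_mem ![1, 0, 1] (Finsupp.single 1 2)
    (by rwa [coeff_weightedQuadric_one]) ?_ ⊥ r H α
  intro x hx hne
  rcases mem_support_weightedQuadric hx with ⟨rfl, -⟩ | ⟨rfl, -⟩ | ⟨rfl, -⟩ | ⟨rfl, -⟩
  · simp [Finsupp.weight_single]
  · simp [Finsupp.weight_single]
  · simp [Finsupp.weight_single]
  · exact absurd rfl hne

/-- The companion for leading monomial x₂x₃: with weight one on x₄ alone, it is lighter than the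
only other term. -/
theorem eq_zero_of_coeff_weightedQuadric_mul {r : MvPolynomial (Fin 3) B}
    (H : ∀ α, coeff (α + (Finsupp.single 0 1 + Finsupp.single 1 1))
      (weightedQuadric τ 0 1 0 * r) = 0) : r = 0 := by
  ext α
  refine coeff_mem_of_coeff_mul_mem ![0, 0, 1] (Finsupp.single 0 1 + Finsupp.single 1 1)
    (by rw [coeff_weightedQuadric_add]; exact isUnit_one) ?_ ⊥ r H α
  intro x hx hne
  rcases mem_support_weightedQuadric hx with ⟨rfl, -⟩ | ⟨rfl, h⟩ | ⟨rfl, -⟩ | ⟨rfl, h⟩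
  · simp [Finsupp.weight_single]
  · exact absurd rfl h
  · exact absurd rfl hne
  · exact absurd rfl h

/-- A weighted quadric whose quadratic part is nonzero with coefficients that are units or zero is
regular modulo every ideal of the base ring. -/
theorem coeff_mem_of_coeff_weightedQuadric_mul_mem (ha : a = 0 ∨ IsUnit a)
    (hb : b = 0 ∨ IsUnit b) (hc : IsUnit a ∨ IsUnit b ∨ IsUnit c) (J : Ideal B)
    {r : MvPolynomial (Fin 3) B} (H : ∀ α, coeff α (weightedQuadric τ a b c * r) ∈ J)
    (α : Fin 3 →₀ ℕ) : coeff α r ∈ J := by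
  by_cases ha' : IsUnit a
  -- These weights order the monomials as x₂² < x₂x₃ < x₃² < x₄. The first nonzero coefficient among
  -- `a`, `b`, `c` is a unit, and its monomial is the lightest; the other two cases use the same
  -- weights.
  · refine coeff_mem_of_coeff_mul_mem ![0, 1, 3] (Finsupp.single 0 2)
      (by rwa [coeff_weightedQuadric_zero]) ?_ J r (fun α => H _) α
    intro x hx hne
    rcases mem_support_weightedQuadric hx with ⟨rfl, -⟩ | ⟨rfl, -⟩ | ⟨rfl, -⟩ | ⟨rfl, -⟩
    · simp [Finsupp.weight_single]
    · exact absurd rfl hne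
    · simp [Finsupp.weight_single]
    · simp [Finsupp.weight_single]
  have ha0 := ha.resolve_right ha'
  by_cases hb' : IsUnit b
  · refine coeff_mem_of_coeff_mul_mem ![0, 1, 3] (Finsupp.single 0 1 + Finsupp.single 1 1)
      (by rwa [coeff_weightedQuadric_add]) ?_ J r (fun α => H _) α
    intro x hx hne
    rcases mem_support_weightedQuadric hx with ⟨rfl, -⟩ | ⟨rfl, h⟩ | ⟨rfl, -⟩ | ⟨rfl, -⟩
    · simp [Finsupp.weight_single]
    · exact absurd ha0 h
    · exact absurd rfl hne
    · simp [Finsupp.weight_single]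
  have hb0 := hb.resolve_right hb'
  refine coeff_mem_of_coeff_mul_mem ![0, 1, 3] (Finsupp.single 1 2)
    (by rw [coeff_weightedQuadric_one]; exact (hc.resolve_left ha').resolve_left hb') ?_ J r
    (fun α => H _) α
  intro x hx hne
  rcases mem_support_weightedQuadric hx with ⟨rfl, -⟩ | ⟨rfl, h⟩ | ⟨rfl, h⟩ | ⟨rfl, -⟩
  · simp [Finsupp.weight_single]
  · exact absurd ha0 h
  · exact absurd hb0 h
  · exact absurd rfl hne

end WeightedQuadric

/-! ### Normal forms modulo a weighted quadric -/

section NormalForms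

variable {B T : Type*} [CommRing B] [CommRing T] [Algebra B T]

theorem MvPolynomial.coeff_rename_eq_zero_of_notMem_range {σ τ : Type*} {f : σ → τ} {i : τ}
    (hi : i ∉ Set.range f) (p : MvPolynomial σ B) {d : τ →₀ ℕ} (hd : d i ≠ 0) :
    coeff d (rename f p) = 0 := by
  refine coeff_rename_eq_zero _ _ _ fun u hu => ?_
  rw [← hu, Finsupp.mapDomain_of_notMem_range _ _ hi] at hd
  exact absurd rfl hd

theorem coeff_polynomial_aeval_X {σ : Type*} (i : σ) (p : Polynomial B) (n : ℕ) :
    coeff (Finsupp.single i n) (Polynomial.aeval (X i : MvPolynomial σ B) p) = p.coeff n := by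
  classical
  induction p using Polynomial.induction_on' with
  | add p q hp hq => rw [map_add, coeff_add, hp, hq, Polynomial.coeff_add]
  | monomial k a =>
    rw [Polynomial.aeval_monomial, algebraMap_eq, C_mul_X_pow_eq_monomial, coeff_monomial,
      Polynomial.coeff_monomial]
    simp only [(Finsupp.single_injective i).eq_iff]

theorem coeff_polynomial_aeval_X_eq_zero {σ : Type*} {i j : σ} (hij : i ≠ j) (p : Polynomial B)
    {d : σ →₀ ℕ} (hd : d j ≠ 0) :
    coeff d (Polynomial.aeval (X i : MvPolynomial σ B) p) = 0 := by
  classical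
  induction p using Polynomial.induction_on' with
  | add p q hp hq => rw [map_add, coeff_add, hp, hq, add_zero]
  | monomial k a =>
    rw [Polynomial.aeval_monomial, algebraMap_eq, C_mul_X_pow_eq_monomial, coeff_monomial,
      if_neg]
    rintro rfl
    exact hd (Finsupp.single_eq_of_ne hij.symm)

/-- A linear map whose range contains the images of all monomials is surjective. -/
theorem LinearMap.surjective_of_monomial_mem_range {M : Type*} [AddCommGroup M] [Module B M]
    (Φ : M →ₗ[B] T) (θ : MvPolynomial (Fin 3) B →ₐ[B] T) (hθ : Function.Surjective θ)
    (H : ∀ i j k : ℕ, θ (X 0) ^ i * θ (X 1) ^ j * θ (X 2) ^ k ∈ LinearMap.range Φ) :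
    Function.Surjective Φ := by
  rw [← LinearMap.range_eq_top, eq_top_iff]
  rintro x -
  obtain ⟨p, rfl⟩ := hθ x
  induction p using MvPolynomial.induction_on' with
  | monomial α a =>
    have h := Submodule.smul_mem _ a (H (α 0) (α 1) (α 2))
    rwa [← map_pow, ← map_pow, ← map_pow, ← map_mul, ← map_mul, ← map_smul, smul_eq_C_mul,
      show C a * (X 0 ^ α 0 * X 1 ^ α 1 * X 2 ^ α 2) = monomial α a by
        rw [monomial_eq, Finsupp.prod_fintype _ _ (by simp), Fin.prod_univ_three]] at h
  | add p q hp hq =>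
    rw [map_add]
    exact add_mem hp hq

variable {τ a b c : B} (θ : MvPolynomial (Fin 3) B →ₐ[B] T) (hθ : Function.Surjective θ)

include hθ

/-- The normal form modulo a weighted quadric with a unit as coefficient of `x₃²`. -/
theorem bijective_aeval_add_mul_aeval (hc : IsUnit c)
    (hker : ∀ p, θ p = 0 ↔ weightedQuadric τ a b c ∣ p) :
    Function.Bijective (fun p : MvPolynomial (Fin 2) B × MvPolynomial (Fin 2) B =>
      aeval ![θ (X 0), θ (X 2)] p.1 + θ (X 1) * aeval ![θ (X 0), θ (X 2)] p.2) := by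
  let Φ : MvPolynomial (Fin 2) B × MvPolynomial (Fin 2) B →ₗ[B] T :=
    (aeval ![θ (X 0), θ (X 2)]).toLinearMap.coprod
      (LinearMap.mulLeft B (θ (X 1)) ∘ₗ (aeval ![θ (X 0), θ (X 2)]).toLinearMap)
  change Function.Bijective Φ
  have hΦ (p q) : Φ (p, q) = aeval ![θ (X 0), θ (X 2)] p +
    θ (X 1) * aeval ![θ (X 0), θ (X 2)] q := rfl
  have hren (p : MvPolynomial (Fin 2) B) :
      aeval ![θ (X 0), θ (X 2)] p = θ (rename ![0, 2] p) := by
    rw [← AlgHom.comp_apply]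
    congr 1
    ext i
    fin_cases i <;> simp
  have hinj : Function.Injective (![0, 2] : Fin 2 → Fin 3) := by decide
  have h1 : (1 : Fin 3) ∉ Set.range (![0, 2] : Fin 2 → Fin 3) := by
    rintro ⟨i, hi⟩
    fin_cases i <;> simp at hi
  constructor
  · rw [injective_iff_map_eq_zero]
    rintro ⟨p, q⟩ h
    rw [hΦ, hren, hren, ← map_mul, ← map_add, hker] at h
    obtain ⟨r, hr⟩ := h
    -- The left side of `hr` has degree at most one in x₃, so it contains no multiple of x₃².
    have hr0 : r = 0 := by
      refine eq_zero_of_coeff_weightedQuadric_mul_of_isUnit_right (τ := τ) (a := a) (b := b)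
        hc fun α => ?_
      have h2 : α + Finsupp.single 1 2 =
          Finsupp.single 1 1 + (α + Finsupp.single 1 1) := by
        rw [add_left_comm, ← Finsupp.single_add]
      rw [← hr, coeff_add, coeff_rename_eq_zero_of_notMem_range h1 _ (by simp), h2, coeff_X_mul,
        coeff_rename_eq_zero_of_notMem_range h1 _ (by simp), add_zero]
    rw [hr0, mul_zero] at hr
    have hp : p = 0 := by
      ext α
      have h2 := congrArg (coeff (α.mapDomain ![0, 2])) hr
      rw [coeff_add, coeff_rename_mapDomain _ hinj, coeff_X_mul', if_neg, add_zero] at h2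
      · exact h2
      · rw [Finsupp.notMem_support_iff, Finsupp.mapDomain_of_notMem_range _ _ h1]
    have hq : q = 0 := by
      ext α
      have h2 := congrArg (coeff (Finsupp.single 1 1 + α.mapDomain ![0, 2])) hr
      rw [coeff_add, coeff_X_mul, coeff_rename_mapDomain _ hinj,
        coeff_rename_eq_zero_of_notMem_range h1 _ (by simp), zero_add] at h2
      exact h2
    rw [hp, hq]
    rfl
  · refine LinearMap.surjective_of_monomial_mem_range Φ θ hθ fun i j k => ?_
    have hrel : θ (weightedQuadric τ a b c) = 0 := (hker _).2 dvd_rfl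
    simp only [weightedQuadric, map_add, map_mul, map_pow, ← smul_eq_C_mul, map_smul] at hrel
    -- The relation trades x₃² for lower powers of x₃, at the price of higher powers of x₂ and x₄;
    -- hence `i` and `k` vary.
    induction j using Nat.twoStepInduction generalizing i k with
    | zero => exact ⟨(X 0 ^ i * X 1 ^ k, 0), by simp [hΦ]⟩
    | one => exact ⟨(0, X 0 ^ i * X 1 ^ k), by simp [hΦ]; ring⟩
    | more j ih ih' =>
      have h2 := add_mem (Submodule.smul_mem _ τ (ih i (k + 1)))
        (add_mem (Submodule.smul_mem _ a (ih (i + 2) k)) (Submodule.smul_mem _ b (ih' (i + 1) k)))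
      have h3 : c • (θ (X 0) ^ i * θ (X 1) ^ (j + 2) * θ (X 2) ^ k) ∈ LinearMap.range Φ := by
        convert neg_mem h2 using 1
        simp only [Algebra.smul_def] at hrel ⊢
        linear_combination (θ (X 0) ^ i * θ (X 1) ^ j * θ (X 2) ^ k) * hrel
      obtain ⟨u, rfl⟩ := hc
      have h4 := Submodule.smul_mem _ (↑u⁻¹ : B) h3
      rwa [smul_smul, Units.inv_mul, one_smul] at h4

/-- The normal form modulo `τ x₄ + x₂ x₃`. -/
theorem bijective_aeval_add_mul_aeval_add_mul_aeval
    (hker : ∀ p, θ p = 0 ↔ weightedQuadric τ 0 1 0 ∣ p) :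
    Function.Bijective (fun p : Polynomial B × MvPolynomial (Fin 2) B × MvPolynomial (Fin 2) B =>
      Polynomial.aeval (θ (X 2)) p.1 + θ (X 0) * aeval ![θ (X 0), θ (X 2)] p.2.1 +
        θ (X 1) * aeval ![θ (X 1), θ (X 2)] p.2.2) := by
  let Φ : Polynomial B × MvPolynomial (Fin 2) B × MvPolynomial (Fin 2) B →ₗ[B] T :=
    (Polynomial.aeval (θ (X 2))).toLinearMap.coprod
      ((LinearMap.mulLeft B (θ (X 0)) ∘ₗ (aeval ![θ (X 0), θ (X 2)]).toLinearMap).coprod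
        (LinearMap.mulLeft B (θ (X 1)) ∘ₗ (aeval ![θ (X 1), θ (X 2)]).toLinearMap))
  have hΦ (p q r) : Φ (p, q, r) = Polynomial.aeval (θ (X 2)) p +
    (θ (X 0) * aeval ![θ (X 0), θ (X 2)] q + θ (X 1) * aeval ![θ (X 1), θ (X 2)] r) := rfl
  have hfun : (fun p : Polynomial B × MvPolynomial (Fin 2) B × MvPolynomial (Fin 2) B =>
      Polynomial.aeval (θ (X 2)) p.1 + θ (X 0) * aeval ![θ (X 0), θ (X 2)] p.2.1 +
        θ (X 1) * aeval ![θ (X 1), θ (X 2)] p.2.2) = Φ := funext fun p => add_assoc _ _ _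
  rw [hfun]
  have hren (i : Fin 3) (p : MvPolynomial (Fin 2) B) :
      aeval ![θ (X i), θ (X 2)] p = θ (rename ![i, 2] p) := by
    rw [← AlgHom.comp_apply]
    congr 1
    ext j
    fin_cases j <;> simp
  have hinj₀ : Function.Injective (![0, 2] : Fin 2 → Fin 3) := by decide
  have hinj₁ : Function.Injective (![1, 2] : Fin 2 → Fin 3) := by decide
  have h₀ : (1 : Fin 3) ∉ Set.range (![0, 2] : Fin 2 → Fin 3) := by
    rintro ⟨i, hi⟩
    fin_cases i <;> simp at hi
  have h₁ : (0 : Fin 3) ∉ Set.range (![1, 2] : Fin 2 → Fin 3) := by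
    rintro ⟨i, hi⟩
    fin_cases i <;> simp at hi
  constructor
  · rw [injective_iff_map_eq_zero]
    rintro ⟨p, q, r⟩ h
    rw [hΦ, hren, hren, ← map_mul, ← map_mul, ← map_add, Polynomial.aeval_algHom_apply,
      ← map_add, hker] at h
    obtain ⟨s, hs⟩ := h
    -- No monomial on the left side of `hs` is divisible by x₂x₃.
    have hs0 : s = 0 := by
      refine eq_zero_of_coeff_weightedQuadric_mul (τ := τ) fun α => ?_
      have h2 : α + (Finsupp.single 0 1 + Finsupp.single 1 1) =
          Finsupp.single 0 1 + (α + Finsupp.single 1 1) := add_left_comm _ _ _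
      have h3 : α + (Finsupp.single 0 1 + Finsupp.single 1 1) =
          Finsupp.single 1 1 + (α + Finsupp.single 0 1) := by rw [h2]; abel
      rw [← hs, coeff_add, coeff_polynomial_aeval_X_eq_zero (j := 0) (by decide) _ (by simp),
        coeff_add, h2, coeff_X_mul, coeff_rename_eq_zero_of_notMem_range h₀ _ (by simp), ← h2, h3,
        coeff_X_mul, coeff_rename_eq_zero_of_notMem_range h₁ _ (by simp), add_zero, add_zero]
    rw [hs0, mul_zero] at hs
    have hp : p = 0 := by
      ext n
      have h2 := congrArg (coeff (Finsupp.single 2 n)) hs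
      rwa [coeff_add, coeff_polynomial_aeval_X, coeff_add, coeff_X_mul', if_neg (by simp),
        coeff_X_mul', if_neg (by simp), add_zero, add_zero] at h2
    have hq : q = 0 := by
      ext α
      have h2 := congrArg (coeff (Finsupp.single 0 1 + α.mapDomain ![0, 2])) hs
      rwa [coeff_add, coeff_polynomial_aeval_X_eq_zero (j := 0) (by decide) _ (by simp),
        coeff_add, coeff_X_mul, coeff_rename_mapDomain _ hinj₀, coeff_X_mul', if_neg, add_zero,
        zero_add] at h2
      rw [Finsupp.notMem_support_iff, Finsupp.add_apply,
        Finsupp.mapDomain_of_notMem_range _ _ h₀]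
      simp
    have hr : r = 0 := by
      ext α
      have h2 := congrArg (coeff (Finsupp.single 1 1 + α.mapDomain ![1, 2])) hs
      rwa [coeff_add, coeff_polynomial_aeval_X_eq_zero (j := 1) (by decide) _ (by simp),
        coeff_add, coeff_X_mul, coeff_rename_mapDomain _ hinj₁, coeff_X_mul', if_neg, zero_add,
        zero_add] at h2
      rw [Finsupp.notMem_support_iff, Finsupp.add_apply,
        Finsupp.mapDomain_of_notMem_range _ _ h₁]
      simp
    rw [hp, hq, hr]
    rfl
  · refine LinearMap.surjective_of_monomial_mem_range Φ θ hθ fun i j k => ?_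
    have hrel : θ (weightedQuadric τ 0 1 0) = 0 := (hker _).2 dvd_rfl
    simp only [weightedQuadric, map_add, map_mul, ← smul_eq_C_mul, map_smul, zero_smul,
      one_smul, zero_add, add_zero] at hrel
    induction i generalizing j k with
    | zero =>
      cases j with
      | zero => exact ⟨(Polynomial.X ^ k, 0, 0), by simp [hΦ]⟩
      | succ j => exact ⟨(0, 0, X 0 ^ j * X 1 ^ k), by simp [hΦ]; ring⟩
    | succ i ih =>
      cases j with
      | zero => exact ⟨(0, X 0 ^ i * X 1 ^ k, 0), by simp [hΦ]; ring⟩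
      | succ j =>
        -- A factor x₂x₃ is replaced by -τ x₄, which lowers both exponents.
        convert neg_mem (Submodule.smul_mem _ τ (ih j (k + 1))) using 1
        simp only [Algebra.smul_def] at hrel ⊢
        linear_combination (θ (X 0) ^ i * θ (X 1) ^ j * θ (X 2) ^ k) * hrel

end NormalForms

/-! ### Symmetric powers and symmetric squares -/

section SymmetricPower

universe u

variable {R ι : Type u} [CommRing R] {M N : Type*} [AddCommGroup M] [Module R M]
  [AddCommGroup N] [Module R N]

namespace SymmetricPower

/-- The linear map on a symmetric power induced by a symmetric multilinear map. -/
noncomputable def lift (φ : MultilinearMap R (fun _ : ι => M) N)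
    (hφ : ∀ (e : Equiv.Perm ι) (f : ι → M), φ (fun i => f (e i)) = φ f) :
    SymmetricPower R ι M →ₗ[R] N where
  -- The symmetric power is the quotient of the tensor power by an additive congruence, so only
  -- additivity descends at once and scalars are checked afterwards.
  __ := AddCon.lift _ (PiTensorProduct.lift φ).toAddMonoidHom <| AddCon.addConGen_le.2 <| by
    intro x y h
    obtain ⟨e, f⟩ := h
    rw [AddCon.ker_rel, LinearMap.toAddMonoidHom_coe, PiTensorProduct.lift.tprod,
      PiTensorProduct.lift.tprod, hφ]
  map_smul' r x := by
    induction x using AddCon.induction_on with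
    | H x => exact map_smul (PiTensorProduct.lift φ) r x

theorem lift_tprod (φ : MultilinearMap R (fun _ : ι => M) N)
    (hφ : ∀ (e : Equiv.Perm ι) (f : ι → M), φ (fun i => f (e i)) = φ f) (f : ι → M) :
    lift φ hφ (tprod R f) = φ f :=
  PiTensorProduct.lift.tprod f

end SymmetricPower

end SymmetricPower

section SymmetricSquare

variable {R : Type} [CommRing R] {M N : Type*} [AddCommGroup M] [Module R M]
  [AddCommGroup N] [Module R N]

namespace SymmetricPower

theorem tprod_two_comm (x y : M) : tprod R ![x, y] = tprod R ![y, x] := by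
  rw [← tprod_equiv (Equiv.swap 0 1) ![x, y]]
  congr 1
  ext i
  fin_cases i <;> simp

theorem tprod_two_add (x x' y : M) :
    tprod R ![x + x', y] = tprod R ![x, y] + tprod R ![x', y] :=
  MultilinearMap.cons_add _ _ _ _

theorem tprod_two_smul (r : R) (x y : M) : tprod R ![r • x, y] = r • tprod R ![x, y] :=
  MultilinearMap.cons_smul _ _ _ _

/-- The linear map on the symmetric square induced by a symmetric bilinear map. -/
theorem exists_lift_two (φ : M →ₗ[R] M →ₗ[R] N) (hφ : ∀ x y, φ x y = φ y x) :
    ∃ Φ : Sym[R]^2 M →ₗ[R] N, ∀ x y, Φ (tprod R ![x, y]) = φ x y := by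
  let ψ : MultilinearMap R (fun _ : Fin 2 => M) N :=
    { toFun := fun v => φ (v 0) (v 1)
      map_update_add' := by
        intro _ v i x y
        fin_cases i <;> simp
      map_update_smul' := by
        intro _ v i c x
        fin_cases i <;> simp }
  have hψ (v : Fin 2 → M) : ψ v = φ (v 0) (v 1) := rfl
  refine ⟨lift ψ ?_, fun x y => lift_tprod ψ _ _⟩
  intro e f
  rw [hψ, hψ]
  -- Only the identity and the swap remain; the swap is the symmetry of `φ`.
  have he : e 0 ≠ e 1 := e.injective.ne (by decide)
  generalize e 0 = i at *
  generalize e 1 = j at *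
  fin_cases i <;> fin_cases j <;> first | exact absurd rfl he | rfl | exact hφ _ _

/-- The symmetric square of a module with two generators has three generators. -/
theorem exists_eq_of_generators {u v : M} (huv : ∀ x : M, ∃ α β : R, x = α • u + β • v)
    (s : Sym[R]^2 M) : ∃ α β γ : R,
      s = α • tprod R ![u, u] + β • tprod R ![u, v] + γ • tprod R ![v, v] := by
  have hs : s ∈ Submodule.span R (Set.range (tprod R (ι := Fin 2) (M := M))) := by
    rw [span_tprod_eq_top]
    trivial
  induction hs using Submodule.span_induction with
  | mem s hs =>
    obtain ⟨f, rfl⟩ := hs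
    obtain ⟨α, β, h0⟩ := huv (f 0)
    obtain ⟨γ, δ, h1⟩ := huv (f 1)
    have hf : f = ![f 0, f 1] := by
      ext i
      fin_cases i <;> rfl
    refine ⟨α * γ, α * δ + β * γ, β * δ, ?_⟩
    rw [hf, h0, h1, tprod_two_add, tprod_two_smul, tprod_two_smul, tprod_two_comm u,
      tprod_two_comm v, tprod_two_add, tprod_two_add, tprod_two_smul, tprod_two_smul,
      tprod_two_smul, tprod_two_smul, tprod_two_comm v u]
    module
  | zero => exact ⟨0, 0, 0, by simp⟩
  | add s t _ _ hs ht =>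
    obtain ⟨α, β, γ, rfl⟩ := hs
    obtain ⟨α', β', γ', rfl⟩ := ht
    exact ⟨α + α', β + β', γ + γ', by module⟩
  | smul r s _ hs =>
    obtain ⟨α, β, γ, rfl⟩ := hs
    exact ⟨r * α, r * β, r * γ, by module⟩

end SymmetricPower

end SymmetricSquare

/-! ### Polynomials of weighted degree one and two -/

section LowDegree

variable {B : Type*} [CommRing B]

theorem Finsupp.eq_single_of_fin_three {x : Fin 3 →₀ ℕ} {i j k : ℕ} (h0 : x 0 = i) (h1 : x 1 = j)
    (h2 : x 2 = k) : x = Finsupp.single 0 i + Finsupp.single 1 j + Finsupp.single 2 k := by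
  ext l
  fin_cases l <;> simp [h0, h1, h2]

theorem weight_fin_three (w : Fin 3 → ℕ) (x : Fin 3 →₀ ℕ) :
    Finsupp.weight w x = x 0 * w 0 + x 1 * w 1 + x 2 * w 2 := by
  simp [Finsupp.weight_eq_sum, Fin.sum_univ_three]

/-- The weight 3 of x₄ excludes it here, and likewise in degree two below. -/
theorem MvPolynomial.IsWeightedHomogeneous.eq_linear {p : MvPolynomial (Fin 3) B}
    (hp : p.IsWeightedHomogeneous ![1, 1, 3] 1) : ∃ α β : B, p = C α * X 0 + C β * X 1 := by
  classical
  refine ⟨coeff (Finsupp.single 0 1) p, coeff (Finsupp.single 1 1) p, ?_⟩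
  rw [C_mul_X_eq_monomial, C_mul_X_eq_monomial]
  ext x
  rw [coeff_add, coeff_monomial, coeff_monomial]
  by_cases hx : coeff x p = 0
  · rw [hx]
    split_ifs with h1 h2 h2 <;> simp_all
  · have h := hp hx
    rw [weight_fin_three] at h
    simp only [Matrix.cons_val] at h
    have h2 : x 2 = 0 := by omega
    obtain ⟨h0, h1⟩ | ⟨h0, h1⟩ : (x 0 = 1 ∧ x 1 = 0) ∨ (x 0 = 0 ∧ x 1 = 1) := by omega
    · obtain rfl : x = Finsupp.single 0 1 := by simpa using Finsupp.eq_single_of_fin_three h0 h1 h2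
      simp [Finsupp.single_eq_single_iff]
    · obtain rfl : x = Finsupp.single 1 1 := by simpa using Finsupp.eq_single_of_fin_three h0 h1 h2
      simp [Finsupp.single_eq_single_iff]

theorem MvPolynomial.IsWeightedHomogeneous.eq_weightedQuadric {p : MvPolynomial (Fin 3) B}
    (hp : p.IsWeightedHomogeneous ![1, 1, 3] 2) : ∃ a b c : B, p = weightedQuadric 0 a b c := by
  classical
  refine ⟨coeff (Finsupp.single 0 2) p, coeff (Finsupp.single 0 1 + Finsupp.single 1 1) p,
    coeff (Finsupp.single 1 2) p, ?_⟩
  ext x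
  by_cases hx : coeff x p = 0
  · rw [hx, eq_comm]
    by_contra h
    rcases mem_support_weightedQuadric (mem_support_iff.2 h) with h | h | h | h
    · exact h.2 rfl
    · rw [h.1] at hx
      exact h.2 hx
    · rw [h.1] at hx
      exact h.2 hx
    · rw [h.1] at hx
      exact h.2 hx
  · have h := hp hx
    rw [weight_fin_three] at h
    simp only [Matrix.cons_val] at h
    have h2 : x 2 = 0 := by omega
    obtain ⟨h0, h1⟩ | ⟨h0, h1⟩ | ⟨h0, h1⟩ :
      (x 0 = 2 ∧ x 1 = 0) ∨ (x 0 = 1 ∧ x 1 = 1) ∨ (x 0 = 0 ∧ x 1 = 2) := by omega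
    · obtain rfl : x = Finsupp.single 0 2 := by simpa using Finsupp.eq_single_of_fin_three h0 h1 h2
      rw [coeff_weightedQuadric_zero]
    · obtain rfl : x = Finsupp.single 0 1 + Finsupp.single 1 1 := by
        simpa using Finsupp.eq_single_of_fin_three h0 h1 h2
      rw [coeff_weightedQuadric_add]
    · obtain rfl : x = Finsupp.single 1 2 := by simpa using Finsupp.eq_single_of_fin_three h0 h1 h2
      rw [coeff_weightedQuadric_one]

theorem weightedQuadric_eq_zero {a b c : B} (h : weightedQuadric 0 a b c = 0) :
    a = 0 ∧ b = 0 ∧ c = 0 := by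
  refine ⟨?_, ?_, ?_⟩
  · rw [← coeff_weightedQuadric_zero (τ := 0) (a := a) (b := b) (c := c), h, coeff_zero]
  · rw [← coeff_weightedQuadric_add (τ := 0) (a := a) (b := b) (c := c), h, coeff_zero]
  · rw [← coeff_weightedQuadric_one (τ := 0) (a := a) (b := b) (c := c), h, coeff_zero]

/-- A binary quadratic form is determined by its three coefficients. -/
theorem MvPolynomial.IsHomogeneous.eq_binary_quadratic {p : MvPolynomial (Fin 2) B}
    (hp : p.IsHomogeneous 2) :
    p = C (coeff (Finsupp.single 0 2) p) * X 0 ^ 2 +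
      C (coeff (Finsupp.single 0 1 + Finsupp.single 1 1) p) * (X 0 * X 1) +
      C (coeff (Finsupp.single 1 2) p) * X 1 ^ 2 := by
  classical
  have hne (i : Fin 2) : (Finsupp.single 0 1 + Finsupp.single 1 1 : Fin 2 →₀ ℕ) ≠
      Finsupp.single i 2 := by
    intro h
    have h0 := DFunLike.congr_fun h 0
    have h1 := DFunLike.congr_fun h 1
    fin_cases i <;> simp at h0 h1
  have hX : C (coeff (Finsupp.single 0 1 + Finsupp.single 1 1) p) *
      ((X 0 : MvPolynomial (Fin 2) B) * X 1) =
      monomial (Finsupp.single 0 1 + Finsupp.single 1 1)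
        (coeff (Finsupp.single 0 1 + Finsupp.single 1 1) p) := by
    rw [X, X, monomial_mul, C_mul_monomial]
    simp
  rw [hX, C_mul_X_pow_eq_monomial, C_mul_X_pow_eq_monomial]
  ext x
  simp only [coeff_add, coeff_monomial]
  by_cases hx : coeff x p = 0
  · split_ifs <;> simp_all
  · have h : x 0 + x 1 = 2 := by
      have := hp hx
      simpa [Finsupp.weight_eq_sum, Fin.sum_univ_two] using this
    have hx' {i j : ℕ} (h0 : x 0 = i) (h1 : x 1 = j) :
        x = Finsupp.single 0 i + Finsupp.single 1 j := by
      ext l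
      fin_cases l <;> simp [h0, h1]
    obtain ⟨h0, h1⟩ | ⟨h0, h1⟩ | ⟨h0, h1⟩ :
      (x 0 = 2 ∧ x 1 = 0) ∨ (x 0 = 1 ∧ x 1 = 1) ∨ (x 0 = 0 ∧ x 1 = 2) := by omega
    · obtain rfl : x = Finsupp.single 0 2 := by simpa using hx' h0 h1
      simp [hne, Finsupp.single_eq_single_iff]
    · obtain rfl := hx' h0 h1
      simp [(hne _).symm]
    · obtain rfl : x = Finsupp.single 1 2 := by simpa using hx' h0 h1
      simp [hne, Finsupp.single_eq_single_iff]

end LowDegree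

/-! ### Symbolic powers of the axis, pulled back to power series -/

section Contraction

variable {A R : Type*} [CommRing A] [CommRing R] {π : A →+* R}

/-- The symbolic powers of the image of an ideal `J` under a quotient map. -/
theorem mem_symbolicPower_map_iff (hπ : Function.Surjective π) {J : Ideal A} {n : ℕ} {a : A} :
    π a ∈ symbolicPower (J.map π) n ↔
      ∃ s, Ideal.Quotient.mk (J.map π) (π s) ∈ nonZeroDivisors (R ⧸ J.map π) ∧
        s * a ∈ J ^ n ⊔ RingHom.ker π := by
  have h (s : A) : π s * π a ∈ J.map π ^ n ↔ s * a ∈ J ^ n ⊔ RingHom.ker π := by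
    rw [← Ideal.map_pow, ← map_mul, ← Ideal.mem_comap, Ideal.comap_map_of_surjective' π hπ]
  constructor
  · rintro ⟨s, hs, hsa⟩
    obtain ⟨s, rfl⟩ := hπ s
    exact ⟨s, hs, (h s).1 hsa⟩
  · rintro ⟨s, hs, hsa⟩
    exact ⟨π s, hs, (h s).2 hsa⟩

end Contraction

namespace HypersurfaceRing

open ConvSeries

theorem mk_surjective (h : ConvSeries 4) :
    Function.Surjective (mk h : ConvSeries 4 →+* HypersurfaceRing h) :=
  Ideal.Quotient.mk_surjective

theorem ker_mk (h : ConvSeries 4) :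
    RingHom.ker (mk h : ConvSeries 4 →+* HypersurfaceRing h) = Ideal.span {h} :=
  Ideal.mk_ker

theorem mk_self (h : ConvSeries 4) : (mk h : ConvSeries 4 →+* HypersurfaceRing h) h = 0 := by
  rw [← RingHom.mem_ker, ker_mk]
  exact Ideal.mem_span_singleton_self h

theorem range_normal : Set.range normal = {ConvSeries.x 1, ConvSeries.x 2, ConvSeries.x 3} := by
  ext f
  simp only [Set.mem_range, Fin.exists_fin_succ, Set.mem_insert_iff, Set.mem_singleton_iff]
  simp [normal, eq_comm]

theorem axisIdeal_eq_map (h : ConvSeries 4) :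
    axisIdeal h = (Ideal.span (Set.range normal)).map (mk h : ConvSeries 4 →+* _) := by
  rw [Ideal.map_span, range_normal, axisIdeal, Set.image_insert_eq, Set.image_pair]
  rfl

/-- The restriction of convergent power series to the `x₁`-axis. -/
noncomputable def toAxis (h : ConvSeries 4) : ConvSeries 4 →+* AxisRing h :=
  (Ideal.Quotient.mk (axisIdeal h)).comp (mk h : ConvSeries 4 →+* HypersurfaceRing h)

theorem toAxis_surjective (h : ConvSeries 4) : Function.Surjective (toAxis h) :=
  Ideal.Quotient.mk_surjective.comp (mk_surjective h)

theorem toAxis_algebraMap (h : ConvSeries 4) (c : ℂ) :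
    toAxis h (algebraMap ℂ (ConvSeries 4) c) = algebraMap ℂ (AxisRing h) c := by
  rw [toAxis, RingHom.comp_apply, RingHom.coe_coe, AlgHom.commutes]
  rfl

variable {h : ConvSeries 4} (hJ : h ∈ Ideal.span (Set.range normal))

include hJ

/-- As `h` vanishes on the axis, passing to 𝒪_X first does not change the quotient 𝒪_C. -/
theorem ker_toAxis : RingHom.ker (toAxis h) = Ideal.span (Set.range normal) := by
  rw [toAxis, ← RingHom.comap_ker, Ideal.mk_ker, axisIdeal_eq_map,
    Ideal.comap_map_of_surjective' _ (mk_surjective h), ker_mk, sup_eq_left,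
    Ideal.span_singleton_le_iff_mem]
  exact hJ

theorem isDomain_axisRing : IsDomain (AxisRing h) := by
  have := isPrime_span_normal
  rw [← ker_toAxis hJ] at this
  exact MulEquiv.isDomain _
    (RingHom.quotientKerEquivOfSurjective (toAxis_surjective h)).symm.toMulEquiv

theorem isWeightedQuasiRegular_toAxis {w : Fin 3 → ℕ} (hw : ∀ i, 1 ≤ w i) :
    IsWeightedQuasiRegular w normal (toAxis h) :=
  isWeightedQuasiRegular_normal hw (ker_toAxis hJ).ge

theorem toAxis_x_zero_pow_ne_zero (m : ℕ) : toAxis h (ConvSeries.x 0 ^ m) ≠ 0 := by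
  rw [ne_eq, ← RingHom.mem_ker, ker_toAxis hJ, span_normal_eq_ker, RingHom.mem_ker]
  intro h0
  rw [RingHom.comp_apply, map_pow, toFormal_x] at h0
  have h1 := congrArg (PowerSeries.coeff m) h0
  rw [coeff_formalRestrict, MvPowerSeries.X_pow_eq, MvPowerSeries.coeff_monomial_same,
    map_zero] at h1
  exact one_ne_zero h1

/-- Since 𝒪_C is a domain, the admissible multipliers are the series that do not vanish on the axis.
Membership thus becomes a saturation question in `ConvSeries 4`, where the weight filtration lives.
-/
theorem mk_mem_symbolicPower_iff {n : ℕ} {a : ConvSeries 4} :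
    (mk h : ConvSeries 4 →+* _) a ∈ symbolicPower (axisIdeal h) n ↔
      ∃ s, toAxis h s ≠ 0 ∧ s * a ∈ Ideal.span (Set.range normal) ^ n ⊔ Ideal.span {h} := by
  have := isDomain_axisRing hJ
  have hs (s : ConvSeries 4) : toAxis h s ≠ 0 ↔ Ideal.Quotient.mk (axisIdeal h)
      ((mk h : ConvSeries 4 →+* _) s) ∈ nonZeroDivisors (AxisRing h) :=
    mem_nonZeroDivisors_iff_ne_zero.symm
  simp only [hs, ← ker_mk]
  have h1 := mem_symbolicPower_map_iff (mk_surjective h)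
    (J := Ideal.span (Set.range normal)) (n := n) (a := a)
  rw [← axisIdeal_eq_map] at h1
  exact h1

end HypersurfaceRing

/-! ### The presentation for a nonzero quadratic part -/

namespace HypersurfaceRing

open ConvSeries

section

variable {m : ℕ} {h h₃ : ConvSeries 4} {h₂ : MvPolynomial (Fin 2) ℂ} (hh₂ : h₂.IsHomogeneous 2)
  (hh₃ : h₃ ∈ Ideal.span (Set.range normal) ^ 3)
  (hh : h = ConvSeries.x 0 ^ m * ConvSeries.x 3 +
    MvPolynomial.aeval ![ConvSeries.x 1, ConvSeries.x 2] h₂ + h₃)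

theorem normal_mem (i : Fin 3) : normal i ∈ Ideal.span (Set.range normal) :=
  Ideal.subset_span ⟨i, rfl⟩

include hh₂

theorem aeval_quadratic_eq {S : Type*} [CommRing S] [Algebra ℂ S] (u v : S) :
    aeval ![u, v] h₂ = algebraMap ℂ S (coeff (Finsupp.single 0 2) h₂) * u ^ 2 +
      algebraMap ℂ S (coeff (Finsupp.single 0 1 + Finsupp.single 1 1) h₂) * (u * v) +
      algebraMap ℂ S (coeff (Finsupp.single 1 2) h₂) * v ^ 2 := by
  conv_lhs => rw [hh₂.eq_binary_quadratic]
  simp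

theorem aeval_quadratic_mem :
    aeval ![ConvSeries.x 1, ConvSeries.x 2] h₂ ∈ Ideal.span (Set.range normal) ^ 2 := by
  have h1 : (ConvSeries.x 1 : ConvSeries 4) ∈ Ideal.span (Set.range normal) := normal_mem 0
  have h2 : (ConvSeries.x 2 : ConvSeries 4) ∈ Ideal.span (Set.range normal) := normal_mem 1
  rw [aeval_quadratic_eq hh₂]
  refine add_mem (add_mem ?_ ?_) ?_
  · exact Ideal.mul_mem_left _ _ (Ideal.pow_mem_pow h1 2)
  · rw [pow_two]
    exact Ideal.mul_mem_left _ _ (Ideal.mul_mem_mul h1 h2)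
  · exact Ideal.mul_mem_left _ _ (Ideal.pow_mem_pow h2 2)

theorem relation_eq_weightedQuadric (h : ConvSeries 4) (m : ℕ) :
    relation h m h₂ = weightedQuadric (t h ^ m)
      (algebraMap ℂ (AxisRing h) (coeff (Finsupp.single 0 2) h₂))
      (algebraMap ℂ (AxisRing h) (coeff (Finsupp.single 0 1 + Finsupp.single 1 1) h₂))
      (algebraMap ℂ (AxisRing h) (coeff (Finsupp.single 1 2) h₂)) := by
  rw [relation, weightedQuadric, aeval_quadratic_eq hh₂, map_pow]
  rfl

/-- Nonzero complex numbers stay units in 𝒪_C, so h₂ ≠ 0 supplies a unit coefficient. Used with `J =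
⊥` for regularity and with `J` principal for saturation. -/
theorem coeff_mem_of_coeff_relation_mul_mem (h0 : h₂ ≠ 0) (J : Ideal (AxisRing h))
    {r : MvPolynomial (Fin 3) (AxisRing h)} (H : ∀ α, coeff α (relation h m h₂ * r) ∈ J)
    (α : Fin 3 →₀ ℕ) : coeff α r ∈ J := by
  rw [relation_eq_weightedQuadric hh₂] at H
  have hu (c : ℂ) : algebraMap ℂ (AxisRing h) c = 0 ∨ IsUnit (algebraMap ℂ (AxisRing h) c) := by
    by_cases hc : c = 0
    · exact Or.inl (by rw [hc, map_zero])
    · exact Or.inr ((isUnit_iff_ne_zero.2 hc).map _)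
  refine coeff_mem_of_coeff_weightedQuadric_mul_mem (hu _) (hu _) ?_ J H α
  by_contra! hc
  refine h0 ?_
  have hz (c : ℂ) (hc : ¬ IsUnit (algebraMap ℂ (AxisRing h) c)) : c = 0 := by
    by_contra hc0
    exact hc ((isUnit_iff_ne_zero.2 hc0).map _)
  rw [hh₂.eq_binary_quadratic, hz _ hc.1, hz _ hc.2.1, hz _ hc.2.2]
  simp

include hh₃ hh

theorem equation_mem_span_normal : h ∈ Ideal.span (Set.range normal) := by
  rw [hh]
  exact add_mem (add_mem (Ideal.mul_mem_left _ _ (normal_mem 2))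
    (Ideal.pow_le_self two_ne_zero (aeval_quadratic_mem hh₂)))
    (Ideal.pow_le_self three_ne_zero hh₃)

/-- The multiplier is x₁ᵐ: modulo `h`, its product with x₄ is -(h₂ + h₃). -/
theorem x_three_mem_symbolicPower_two : x h 3 ∈ symbolicPower (axisIdeal h) 2 := by
  have hJ := equation_mem_span_normal hh₂ hh₃ hh
  refine (mk_mem_symbolicPower_iff hJ).2 ⟨ConvSeries.x 0 ^ m, toAxis_x_zero_pow_ne_zero hJ m, ?_⟩
  have h1 : ConvSeries.x 0 ^ m * ConvSeries.x 3 =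
      -(aeval ![ConvSeries.x 1, ConvSeries.x 2] h₂ + h₃) + h := by
    rw [hh]
    ring
  rw [h1]
  exact add_mem (Submodule.mem_sup_left (neg_mem (add_mem (aeval_quadratic_mem hh₂)
    (Ideal.pow_le_pow_right (by norm_num) hh₃))))
    (Submodule.mem_sup_right (Ideal.mem_span_singleton_self h))

/-- The initial form of the equation for the weights `1, 1, 2`. -/
theorem isSymbol_equation : IsSymbol ![1, 1, 2] normal (toAxis h) 2 h (relation h m h₂) := by
  have hC (c : ℂ) : IsSymbol ![1, 1, 2] normal (toAxis h) 0 (algebraMap ℂ (ConvSeries 4) c)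
      (C (algebraMap ℂ (AxisRing h) c)) := by
    rw [← toAxis_algebraMap]
    exact IsSymbol.C_apply _
  have h0 : IsSymbol ![1, 1, 2] normal (toAxis h) 1 (ConvSeries.x 1) (X 0) := IsSymbol.X 0
  have h1 : IsSymbol ![1, 1, 2] normal (toAxis h) 1 (ConvSeries.x 2) (X 1) := IsSymbol.X 1
  have h2 : IsSymbol ![1, 1, 2] normal (toAxis h) 2 (ConvSeries.x 3) (X 2) := IsSymbol.X 2
  have ht : IsSymbol ![1, 1, 2] normal (toAxis h) 0 (ConvSeries.x 0 ^ m) (C (t h ^ m)) := by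
    have := IsSymbol.C_apply (w := ![1, 1, 2]) (y := normal) (ρ := toAxis h) (ConvSeries.x 0 ^ m)
    rwa [map_pow] at this
  -- The cubic part has order at least three, so it is invisible in degree two.
  have h3 : IsSymbol ![1, 1, 2] normal (toAxis h) 2 h₃ 0 :=
    IsSymbol.of_mem_succ (pow_span_le_weightFiltration (by decide) 3 hh₃)
  rw [relation_eq_weightedQuadric hh₂, weightedQuadric]
  have h4 := ((ht.mul h2).add ((((hC (coeff (Finsupp.single 0 2) h₂)).mul (h0.pow 2)).add
    ((hC (coeff (Finsupp.single 0 1 + Finsupp.single 1 1) h₂)).mul (h0.mul h1))).add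
    ((hC (coeff (Finsupp.single 1 2) h₂)).mul (h1.pow 2)))).add h3
  rw [add_zero, ← aeval_quadratic_eq hh₂, ← hh] at h4
  exact h4

/-- The hard comparison: the right side contains the n-th power of the axis ideal and `h`, and it is
saturated. -/
theorem comap_symbolicPower_le (h0 : h₂ ≠ 0) (n : ℕ) :
    (symbolicPower (axisIdeal h) n).comap (mk h : ConvSeries 4 →+* HypersurfaceRing h) ≤
      weightFiltration ![1, 1, 2] normal n ⊔ Ideal.span {h} := by
  intro a ha
  have hJ := equation_mem_span_normal hh₂ hh₃ hh
  have := isDomain_axisRing hJ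
  have hw : ∀ i, 1 ≤ (![1, 1, 2] : Fin 3 → ℕ) i := by decide
  obtain ⟨s, hs, hsa⟩ := (mk_mem_symbolicPower_iff hJ).1 ha
  have hle : Ideal.span (Set.range normal) ^ n ⊔ Ideal.span {h} ≤
      weightFiltration ![1, 1, 2] normal n ⊔ Ideal.span {h} :=
    sup_le_sup_right (pow_span_le_weightFiltration hw n) _
  refine mem_weightFiltration_sup_of_mul_mem hw (ker_toAxis hJ).le
    (isWeightedQuasiRegular_toAxis hJ hw) (isSymbol_equation hh₂ hh₃ hh) ?_
    (toAxis_surjective h) hs ?_ (hle hsa)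
  · intro r hr
    ext α
    exact coeff_mem_of_coeff_relation_mul_mem (m := m) hh₂ h0 ⊥ (fun α => by rw [hr]; simp) α
  · intro r p hrp
    -- Divisibility by a constant is tested on coefficients, so this is regularity of the relation
    -- modulo a principal ideal.
    rw [C_dvd_iff_dvd_coeff]
    intro α
    rw [← Ideal.mem_span_singleton]
    refine coeff_mem_of_coeff_relation_mul_mem (m := m) hh₂ h0 _ (fun α => ?_) α
    rw [hrp, coeff_C_mul, Ideal.mem_span_singleton]
    exact dvd_mul_right _ _

theorem normal_mem_symbolicPower (i : Fin 3) : (mk h : ConvSeries 4 →+* HypersurfaceRing h)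
    (normal i) ∈ symbolicPower (axisIdeal h) (![1, 1, 2] i) := by
  fin_cases i
  · exact x_one_mem h
  · exact x_two_mem h
  · exact x_three_mem_symbolicPower_two hh₂ hh₃ hh

/-- The presentation of the graded algebra by `x₂, x₃, x₄`, for `h₂ ≠ 0`. -/
theorem exists_presentation (h0 : h₂ ≠ 0) :
    ∃ θ : MvPolynomial (Fin 3) (AxisRing h) →ₐ[AxisRing h] GrAlgebra (axisIdeal h),
      θ (X 0) = GrAlgebra.cls 1 (x h 1) (x_one_mem h) ∧
      θ (X 1) = GrAlgebra.cls 1 (x h 2) (x_two_mem h) ∧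
      θ (X 2) = GrAlgebra.cls 2 (x h 3) (x_three_mem_symbolicPower_two hh₂ hh₃ hh) ∧
      Function.Surjective θ ∧ (∀ p, θ p = 0 ↔ relation h m h₂ ∣ p) ∧
      ∀ n, θ '' {p | p.IsWeightedHomogeneous ![1, 1, 2] n} =
        Set.range (DirectSum.of (GrPiece (axisIdeal h)) n) := by
  have hz := normal_mem_symbolicPower hh₂ hh₃ hh
  have hJ := equation_mem_span_normal hh₂ hh₃ hh
  have hw : ∀ i, 1 ≤ (![1, 1, 2] : Fin 3 → ℕ) i := by decide
  have hsymb := isSymbol_equation hh₂ hh₃ hh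
  have hlift (n) (y : GrPiece (axisIdeal h) n) := GrAlgebra.exists_evalCls_eq (mk_surjective h)
    (mk_self h) hz (comap_symbolicPower_le hh₂ hh₃ hh h0 n) y
  refine ⟨GrAlgebra.evalCls hz, GrAlgebra.evalCls_X hz 0, GrAlgebra.evalCls_X hz 1,
    GrAlgebra.evalCls_X hz 2, GrAlgebra.evalCls_surjective hz hlift, fun p => ⟨fun hp => ?_, ?_⟩,
    fun n => ?_⟩
  -- A homogeneous `p` in the kernel is the degree `n` initial form of an element of order greater
  -- than `n` modulo `h`, hence a multiple of the initial form of `h`.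
  · refine GrAlgebra.dvd_of_evalCls_eq_zero hz (fun n p hp hp0 => ?_) hp
    obtain ⟨a, ha, hap⟩ := GrAlgebra.exists_isSymbol_of_evalCls_eq_zero (mk_surjective h) hz
      (comap_symbolicPower_le hh₂ hh₃ hh h0 (n + 1)) hp hp0
    have hreg (r) (hr : relation h m h₂ * r = 0) : r = 0 := by
      ext α
      exact coeff_mem_of_coeff_relation_mul_mem hh₂ h0 ⊥ (fun α => by rw [hr]; simp) α
    rcases IsSymbol.eq_zero_or_eq_mul hw (ker_toAxis hJ).le (isWeightedQuasiRegular_toAxis hJ hw)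
      hsymb hreg hap ha with rfl | ⟨k, r, -, -, rfl⟩
    · exact dvd_zero _
    · exact dvd_mul_right _ _
  · rintro ⟨r, rfl⟩
    obtain ⟨h1, h2⟩ := hsymb.evalsTo (hz := hz)
    rw [map_mul, h2, (GrAlgebra.cls_eq_zero_iff h1).2, zero_mul]
    rw [mk_self]
    exact zero_mem _
  · ext y
    constructor
    · rintro ⟨p, hp, rfl⟩
      obtain ⟨y, hy⟩ := GrAlgebra.exists_of_eq_evalCls hz hp
      exact ⟨y, hy.symm⟩
    · rintro ⟨y, rfl⟩
      obtain ⟨p, hp, hpy⟩ := hlift n y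
      exact ⟨p, hp, hpy⟩

end

/-! ### The case of vanishing quadratic part -/

section

variable {m : ℕ} {h h₃ : ConvSeries 4} (hh₃ : h₃ ∈ Ideal.span (Set.range normal) ^ 3)
  (hh : h = ConvSeries.x 0 ^ m * ConvSeries.x 3 + h₃)

include hh₃ hh

/-- If the equation has no quadratic part, then the multiplication map from the symmetric square of
the conormal module is an isomorphism. -/
theorem exists_symmetricSquare_equiv :
    ∃ e : Sym[AxisRing h]^2 (GrPiece (axisIdeal h) 1) ≃ₗ[AxisRing h] GrPiece (axisIdeal h) 2,
      ∀ a b : GrPiece (axisIdeal h) 1,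
        DirectSum.of (GrPiece (axisIdeal h)) 2
            (e (SymmetricPower.tprod (AxisRing h) ![a, b])) =
          DirectSum.of (GrPiece (axisIdeal h)) 1 a * DirectSum.of (GrPiece (axisIdeal h)) 1 b := by
  have hJ : h ∈ Ideal.span (Set.range normal) := by
    rw [hh]
    exact add_mem (Ideal.mul_mem_left _ _ (normal_mem 2)) (Ideal.pow_le_self three_ne_zero hh₃)
  have := isDomain_axisRing hJ
  -- Without h₂ the equation reads x₁ᵐx₄ = -h₃ on X, which has order three; this is the weight given
  -- to x₄.
  have hw : ∀ i, 1 ≤ (![1, 1, 3] : Fin 3 → ℕ) i := by decide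
  have hq := isWeightedQuasiRegular_toAxis hJ hw
  have hx₄ : x h 3 ∈ symbolicPower (axisIdeal h) 3 := by
    refine (mk_mem_symbolicPower_iff hJ).2
      ⟨ConvSeries.x 0 ^ m, toAxis_x_zero_pow_ne_zero hJ m, ?_⟩
    have h1 : ConvSeries.x 0 ^ m * ConvSeries.x 3 = -h₃ + h := by
      rw [hh]
      ring
    rw [h1]
    exact add_mem (Submodule.mem_sup_left (neg_mem hh₃))
      (Submodule.mem_sup_right (Ideal.mem_span_singleton_self h))
  have hz (i : Fin 3) : (mk h : ConvSeries 4 →+* HypersurfaceRing h) (normal i) ∈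
      symbolicPower (axisIdeal h) (![1, 1, 3] i) := by
    fin_cases i
    · exact x_one_mem h
    · exact x_two_mem h
    · exact hx₄
  have hW : h ∈ weightFiltration ![1, 1, 3] normal 3 := by
    have h1 : (ConvSeries.x 3 : ConvSeries 4) ∈ weightFiltration ![1, 1, 3] normal 3 :=
      apply_mem_weightFiltration (2 : Fin 3)
    have h2 := pow_span_le_weightFiltration hw 3 hh₃
    have h3 := add_mem (Ideal.mul_mem_left _ (ConvSeries.x 0 ^ m) h1) h2
    rwa [← hh] at h3
  -- Up to degree 3 the filtration already contains `h`, so its own saturation suffices and no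
  -- regularity of the initial form of `h` is needed. Degree 3 is what injectivity on gr² requires.
  have hcomap (n : ℕ) (hn : n ≤ 3) : (symbolicPower (axisIdeal h) n).comap
      (mk h : ConvSeries 4 →+* HypersurfaceRing h) ≤ weightFiltration ![1, 1, 3] normal n := by
    intro a ha
    obtain ⟨s, hs, hsa⟩ := (mk_mem_symbolicPower_iff hJ).1 ha
    have hle : Ideal.span (Set.range normal) ^ n ⊔ Ideal.span {h} ≤
        weightFiltration ![1, 1, 3] normal n :=
      sup_le (pow_span_le_weightFiltration hw n)
        ((Ideal.span_singleton_le_iff_mem _).2 (weightFiltration_anti hn hW))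
    exact mem_weightFiltration_of_mul_mem hw (ker_toAxis hJ).le hq hs (hle hsa)
  have hlift (n) (hn : n ≤ 3) (y : GrPiece (axisIdeal h) n) :=
    GrAlgebra.exists_evalCls_eq (mk_surjective h) (mk_self h) hz
      ((hcomap n hn).trans le_sup_left) y
  have hinj (p : MvPolynomial (Fin 3) (AxisRing h)) (hp : p.IsWeightedHomogeneous ![1, 1, 3] 2)
      (h0 : GrAlgebra.evalCls hz p = 0) : p = 0 := by
    obtain ⟨a, ha, hap⟩ := GrAlgebra.exists_isSymbol_of_evalCls_eq_zero (mk_surjective h) hz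
      ((hcomap 3 le_rfl).trans le_sup_left) hp h0
    refine hap.eq_zero hq ?_
    rwa [sup_eq_left.2 ((Ideal.span_singleton_le_iff_mem _).2 hW)] at ha
  let u : GrPiece (axisIdeal h) 1 := GrPiece.mk 1 (x h 1) (x_one_mem h)
  let v : GrPiece (axisIdeal h) 1 := GrPiece.mk 1 (x h 2) (x_two_mem h)
  have hu : GrAlgebra.evalCls hz (X 0) = DirectSum.of (GrPiece (axisIdeal h)) 1 u :=
    GrAlgebra.evalCls_X hz 0
  have hv : GrAlgebra.evalCls hz (X 1) = DirectSum.of (GrPiece (axisIdeal h)) 1 v :=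
    GrAlgebra.evalCls_X hz 1
  have huv (y : GrPiece (axisIdeal h) 1) : ∃ α β : AxisRing h, y = α • u + β • v := by
    obtain ⟨p, hp, hpy⟩ := hlift 1 (by norm_num) y
    obtain ⟨α, β, rfl⟩ := hp.eq_linear
    refine ⟨α, β, DirectSum.of_injective (β := GrPiece (axisIdeal h)) 1 ?_⟩
    rw [← hpy, ← smul_eq_C_mul, ← smul_eq_C_mul, map_add, map_smul, map_smul, hu, hv, map_add,
      DirectSum.of_smul, DirectSum.of_smul]
  let φ : GrPiece (axisIdeal h) 1 →ₗ[AxisRing h] GrPiece (axisIdeal h) 1 →ₗ[AxisRing h]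
      GrPiece (axisIdeal h) 2 := DirectSum.gMulLHom (AxisRing h) (GrPiece (axisIdeal h))
  have hφ (a b) : DirectSum.of (GrPiece (axisIdeal h)) 2 (φ a b) =
      DirectSum.of (GrPiece (axisIdeal h)) 1 a * DirectSum.of (GrPiece (axisIdeal h)) 1 b :=
    (DirectSum.of_mul_of a b).symm
  obtain ⟨Φ, hΦ⟩ := SymmetricPower.exists_lift_two φ fun a b =>
    DirectSum.of_injective (β := GrPiece (axisIdeal h)) 2 (by rw [hφ, hφ, mul_comm])
  -- The three generators of the symmetric square go to the quadratic monomials in x₂, x₃, so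
  -- bijectivity can be read off from polynomials of degree two.
  have hΦ' (α β γ : AxisRing h) : DirectSum.of (GrPiece (axisIdeal h)) 2
      (Φ (α • SymmetricPower.tprod _ ![u, u] + β • SymmetricPower.tprod _ ![u, v] +
        γ • SymmetricPower.tprod _ ![v, v])) =
      GrAlgebra.evalCls hz (weightedQuadric 0 α β γ) := by
    simp only [map_add, map_smul, hΦ, DirectSum.of_smul, hφ, weightedQuadric, map_mul,
      ← smul_eq_C_mul, hu, hv, zero_smul, zero_add, pow_two]
  refine ⟨LinearEquiv.ofBijective Φ ⟨?_, ?_⟩, fun a b => ?_⟩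
  · rw [injective_iff_map_eq_zero]
    intro s hs
    obtain ⟨α, β, γ, rfl⟩ := SymmetricPower.exists_eq_of_generators huv s
    have h1 := hΦ' α β γ
    rw [hs, map_zero] at h1
    have h2 := hinj _ ?_ h1.symm
    · obtain ⟨rfl, rfl, rfl⟩ := weightedQuadric_eq_zero h2
      simp
    · intro x hx
      rcases mem_support_weightedQuadric (mem_support_iff.2 hx) with ⟨-, h⟩ | ⟨rfl, -⟩ |
        ⟨rfl, -⟩ | ⟨rfl, -⟩
      · exact absurd rfl h
      · simp [Finsupp.weight_single]
      · simp [Finsupp.weight_single]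
      · simp [Finsupp.weight_single]
  · intro y
    obtain ⟨p, hp, hpy⟩ := hlift 2 (by norm_num) y
    obtain ⟨α, β, γ, rfl⟩ := hp.eq_weightedQuadric
    exact ⟨_, DirectSum.of_injective (β := GrPiece (axisIdeal h)) 2 ((hΦ' α β γ).trans hpy)⟩
  · exact (congrArg _ (hΦ a b)).trans (hφ a b)

end

end HypersurfaceRing

open HypersurfaceRing in
theorem mainTheorem4 (m : ℕ) (hm : 1 ≤ m) (h h₃ : ConvSeries 4)
    (h₂ : MvPolynomial (Fin 2) ℂ) (hh₂ : h₂.IsHomogeneous 2)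
    (hh₃ : h₃ ∈ (Ideal.span {ConvSeries.x 1, ConvSeries.x 2, ConvSeries.x 3} :
      Ideal (ConvSeries 4)) ^ 3)
    (hh : h = ConvSeries.x 0 ^ m * ConvSeries.x 3 +
      MvPolynomial.aeval ![ConvSeries.x 1, ConvSeries.x 2] h₂ + h₃) :
    -- the multiplication map `S² gr¹ → gr²` is an isomorphism if `h₂ = 0`
    (h₂ = 0 →
      ∃ e : Sym[AxisRing h]^2 (GrPiece (axisIdeal h) 1) ≃ₗ[AxisRing h] GrPiece (axisIdeal h) 2,
        ∀ a b : GrPiece (axisIdeal h) 1,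
          DirectSum.of (GrPiece (axisIdeal h)) 2
              (e (SymmetricPower.tprod (AxisRing h) ![a, b])) =
            DirectSum.of (GrPiece (axisIdeal h)) 1 a * DirectSum.of (GrPiece (axisIdeal h)) 1 b) ∧
    -- `x₄` lies in `I⁽²⁾`; `ξ₂`, `ξ₃`, `ξ₄` are the classes of `x₂`, `x₃`, `x₄` in degrees 1, 1, 2
    ∃ hx₄ : x h 3 ∈ symbolicPower (axisIdeal h) 2,
    ∃ ξ₂ ξ₃ ξ₄ : GrAlgebra (axisIdeal h),
      ξ₂ = GrAlgebra.cls 1 (x h 1) (x_one_mem h) ∧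
      ξ₃ = GrAlgebra.cls 1 (x h 2) (x_two_mem h) ∧
      ξ₄ = GrAlgebra.cls 2 (x h 3) hx₄ ∧
      -- the presentation of `gr^•` as a graded algebra
      (h₂ ≠ 0 →
        ∃ e : (MvPolynomial (Fin 3) (AxisRing h) ⧸ Ideal.span {relation h m h₂})
            ≃ₐ[AxisRing h] GrAlgebra (axisIdeal h),
          e (Ideal.Quotient.mk _ (MvPolynomial.X 0)) = ξ₂ ∧
          e (Ideal.Quotient.mk _ (MvPolynomial.X 1)) = ξ₃ ∧
          e (Ideal.Quotient.mk _ (MvPolynomial.X 2)) = ξ₄ ∧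
          ∀ n : ℕ, (fun p => e (Ideal.Quotient.mk _ p)) ''
              {p | MvPolynomial.IsWeightedHomogeneous ![1, 1, 2] p n} =
            Set.range (DirectSum.of (GrPiece (axisIdeal h)) n)) ∧
      -- `gr^• = 𝒪_C[x₂, x₄] ⊕ x₃ 𝒪_C[x₂, x₄]`
      (h₂.coeff (Finsupp.single 1 2) ≠ 0 →
        Function.Bijective
          (fun p : MvPolynomial (Fin 2) (AxisRing h) × MvPolynomial (Fin 2) (AxisRing h) =>
            MvPolynomial.aeval ![ξ₂, ξ₄] p.1 + ξ₃ * MvPolynomial.aeval ![ξ₂, ξ₄] p.2)) ∧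
      -- `gr^• = 𝒪_C[x₄] ⊕ x₂ 𝒪_C[x₂, x₄] ⊕ x₃ 𝒪_C[x₃, x₄]`
      (h₂ = MvPolynomial.X 0 * MvPolynomial.X 1 →
        Function.Bijective
          (fun p : Polynomial (AxisRing h) × MvPolynomial (Fin 2) (AxisRing h) ×
              MvPolynomial (Fin 2) (AxisRing h) =>
            Polynomial.aeval ξ₄ p.1 + ξ₂ * MvPolynomial.aeval ![ξ₂, ξ₄] p.2.1 +
              ξ₃ * MvPolynomial.aeval ![ξ₃, ξ₄] p.2.2)) := by
  rw [← range_normal] at hh₃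
  refine ⟨fun h0 => exists_symmetricSquare_equiv (m := m) hh₃ (by rw [hh, h0, map_zero, add_zero]),
    x_three_mem_symbolicPower_two hh₂ hh₃ hh, _, _, _, rfl, rfl, rfl, fun h0 => ?_, fun hc => ?_,
    fun h0 => ?_⟩
  · obtain ⟨θ, h2, h3, h4, hsurj, hker, hgr⟩ := exists_presentation hh₂ hh₃ hh h0
    have hrel : Ideal.span {relation h m h₂} = RingHom.ker θ := by
      ext p
      rw [Ideal.mem_span_singleton, RingHom.mem_ker, hker]
    refine ⟨(Ideal.quotientEquivAlgOfEq _ hrel).trans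
      (Ideal.quotientKerAlgEquivOfSurjective hsurj), h2, h3, h4, hgr⟩
  · have h0 : h₂ ≠ 0 := by
      rintro rfl
      exact hc (MvPolynomial.coeff_zero _)
    obtain ⟨θ, h2, h3, h4, hsurj, hker, -⟩ := exists_presentation hh₂ hh₃ hh h0
    rw [← h2, ← h3, ← h4]
    refine bijective_aeval_add_mul_aeval θ hsurj ((isUnit_iff_ne_zero.2 hc).map
      (algebraMap ℂ (AxisRing h))) (τ := t h ^ m)
      (a := algebraMap ℂ _ (MvPolynomial.coeff (Finsupp.single 0 2) h₂))
      (b := algebraMap ℂ _ (MvPolynomial.coeff (Finsupp.single 0 1 + Finsupp.single 1 1) h₂)) ?_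
    rw [← relation_eq_weightedQuadric hh₂]
    exact hker
  · have hne : h₂ ≠ 0 := by
      rw [h0]
      exact mul_ne_zero (MvPolynomial.X_ne_zero _) (MvPolynomial.X_ne_zero _)
    obtain ⟨θ, h2, h3, h4, hsurj, hker, -⟩ := exists_presentation hh₂ hh₃ hh hne
    rw [← h2, ← h3, ← h4]
    refine bijective_aeval_add_mul_aeval_add_mul_aeval θ hsurj (τ := t h ^ m) ?_
    have hrel : relation h m h₂ = weightedQuadric (t h ^ m) 0 1 0 := by
      rw [relation, weightedQuadric, h0]
      simp
    rw [← hrel]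
    exact hker
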